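/- Let $\mathbb F$ be a finite field with $k$ elements and let $\mathcal L=\mathbb F((X^{-1}))$ with the absolute value $\left|\sum_{i\ge -N}a_{-i}X^{-i}\right|=k^{N}$ ($a_N\neq 0$), $|0|=0$. For a vector or matrix over $\mathcal L$ let $\|\cdot\|_\infty$ be the maximum of the absolute values of its entries, and for $\mathbf x\in\mathcal L^n$ put $\langle\mathbf x\rangle=\min_{\mathbf p\in\mathbb F[X]^n}\|\mathbf x-\mathbf p\|_\infty$. For integers $m,n\ge 1$, identify $\mathcal L^{mn}$ with the $m\times n$ matrices over $\mathcal L$ and let $$\mathfrak B(m,n)=\Big\{A\in\mathcal L^{mn}:\ \exists K>0\ \ \forall \mathbf q\in\mathbb F[X]^m\setminus\{0\}\ \ \langle\mathbf qA\rangle^n>\frac{K}{\|\mathbf q\|_\infty^m}\Big\}.$$ A formal ball is a pair $B=(\mathbf c,\rho)$ with $\mathbf c\in\mathcal L^{mn}$, $\rho=\rho(B)\ge 0$; it represents the set $\{A:\|A-\mathbf c\|_\infty\le\rho\}$. For formal balls, $(\mathbf c_1,\rho_1)\subseteq(\mathbf c_2,\rho_2)$ means $\rho_1+\|\mathbf c_1-\mathbf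 c_2\|_\infty\le\rho_2$, and $B^\gamma$ is the set of formal balls $B'\subseteq B$ with $\rho(B')=\gamma\rho(B)$. In the $(\alpha,\beta;S)$-game, $S\subseteq\mathcal L^{mn}$, Black chooses a formal ball $B_1$ of positive radius, White chooses $W_1\in B_1^\alpha$, Black chooses $B_2\in W_1^\beta$, White chooses $W_2\in B_2^\alpha$, and so on; White wins if the intersection of the sets represented by the $B_i$ is contained in $S$. The set $S$ is $\alpha$-winning if, for every $\beta\in(0,1)$, White has a winning strategy in the $(\alpha,\beta;S)$-game; the winning dimension $\operatorname{windim}S$ is the supremum of the $\alpha\in(0,1)$ for which $S$ is $\alpha$-winning ($0$ if there are none). Finite game. Call $\mathbf y_1,\dots,\mathbf y_m\in\mathcal L^{m+n}$ orthonormal if $\|t_1\mathbf y_1+\dots+t_m\mathbf y_m\|_\infty=\max_i|t_i|$ for all $t_i\in\mathcal L$. For $A\in\mathcal L^{mn}$ let $D=D(A)$ be the determinant, and $D_{l,l'}$ ($1\le l,l'\le m$) the cofactors, of the $m\times m$ matrix whose $(i,j)$ entry is the product of $\mathbf y_i$ with the $j$-th column of $\begin{pmatrix}A^T&I_n\\ I_m&0\end{pmatrix}$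 (for $m=1$ the only cofactor is $1$). Given orthonormal $\mathbf y_1,\dots,\mathbf y_m$, a formal ball $B$ with $0<\rho(B)<1$, and $\mu>0$, the players move as in the $(\alpha,\beta)$-game, starting from $B_1=B$, and the game stops at the first ball $B_t$ of Black with $\rho(B_t)<\mu\rho(B)$. White wins it if $|D|>\rho(B)\,\mu\,\max_{l,l'}|D_{l,l'}|$ for every $A\in B_t$. Theorem. Let $m,n\ge 1$. (1) Let $\alpha,\beta\in(0,1)$ satisfy $k^{-1}+\alpha\beta-(k^{-1}+1)\alpha>0$. Then (a) for every $\sigma>0$ there is $\mu^*>0$, depending only on $\alpha,\beta,\sigma$ (and $m,n,\mathbb F$), such that White can win the finite game for all orthonormal $\mathbf y_1,\dots,\mathbf y_m$, all $\mu\in(0,\mu^*)$ and all formal balls $B$ with $0<\rho(B)<1$ and $\|A\|_\infty\le\sigma$ for all $A\in B$; (b) White can win the $(\alpha,\beta;\mathfrak B(m,n))$-game. (2) $\mathfrak B(m,n)$ is $\alpha$-winning for every $\alpha$ with $0<\alpha<\frac1{k+1}$. (3) $\operatorname{windim}\mathfrak B(m,n)\ge\frac1{k+1}$. -/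

import Mathlib

open scoped Polynomial Matrix

namespace BadApprox

/-- The field `𝓛` of formal Laurent series `∑_{i ≥ -N} a_{-i} X^{-i}` over `F`, written as Laurent
series in the variable `X⁻¹`: the coefficient of index `i` is the coefficient of `X^{-i}`. -/
abbrev Series (F : Type*) [Field F] := LaurentSeries F

/-- The element `X` of `𝓛`. -/
noncomputable def seriesX (F : Type*) [Field F] : Series F :=
  HahnSeries.single (-1 : ℤ) (1 : F)

/-- The inclusion of the polynomial ring `F[X]` in `𝓛`. -/
noncomputable def ofPoly {F : Type*} [Field F] (p : F[X]) : Series F :=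
  Polynomial.aeval (seriesX F) p

open Classical in
/-- The absolute value on `𝓛`: `|∑_{i ≥ -N} a_{-i} X^{-i}| = k ^ N` if `a_N ≠ 0`, and `|0| = 0`,
where `k` is the number of elements of `F`. -/
noncomputable def absL {F : Type*} [Field F] [Fintype F] (x : Series F) : ℝ :=
  if x = 0 then 0 else (Fintype.card F : ℝ) ^ (-x.order)

/-- The height of a vector: the maximum of the absolute values of its coordinates. -/
noncomputable def height {F : Type*} [Field F] [Fintype F] {ι : Type*} [Fintype ι]
    (x : ι → Series F) : ℝ :=
  ⨆ i, absL (x i)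

/-- The height of a matrix, seen as a vector of `𝓛^{mn}`. -/
noncomputable def matHeight {F : Type*} [Field F] [Fintype F] {m n : ℕ}
    (A : Matrix (Fin m) (Fin n) (Series F)) : ℝ :=
  height (fun p : Fin m × Fin n => A p.1 p.2)

/-- The distance from a vector to the polynomial lattice. -/
noncomputable def latticeDist {F : Type*} [Field F] [Fintype F] {h : ℕ}
    (x : Fin h → Series F) : ℝ :=
  ⨅ p : Fin h → F[X], height (fun i => x i - ofPoly (p i))

/-- The set `𝔅(m,n)` of badly approximable matrices. -/
def badlyApproximable (F : Type*) [Field F] [Fintype F] (m n : ℕ) :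
    Set (Matrix (Fin m) (Fin n) (Series F)) :=
  {A | ∃ K : ℝ, 0 < K ∧ ∀ q : Fin m → F[X], q ≠ 0 →
    K / height (fun i => ofPoly (q i)) ^ m <
      latticeDist ((fun i => ofPoly (q i)) ᵥ* A) ^ n}

/-! ### Formal balls and the games -/

/-- A formal ball of `𝓛^{mn}`: a centre and a nonnegative radius. -/
structure FormalBall (F : Type*) [Field F] [Fintype F] (m n : ℕ) where
  center : Matrix (Fin m) (Fin n) (Series F)
  radius : ℝ
  radius_nonneg : 0 ≤ radius

/-- The closed ball of `𝓛^{mn}` given by a formal ball. -/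
def FormalBall.toSet {F : Type*} [Field F] [Fintype F] {m n : ℕ} (B : FormalBall F m n) :
    Set (Matrix (Fin m) (Fin n) (Series F)) :=
  {A | matHeight (A - B.center) ≤ B.radius}

/-- Inclusion of formal balls. -/
def FormalBall.Sub {F : Type*} [Field F] [Fintype F] {m n : ℕ} (B₁ B₂ : FormalBall F m n) : Prop :=
  B₁.radius + matHeight (B₁.center - B₂.center) ≤ B₂.radius

/-- `B^γ`: the formal balls included in `B` of radius `γ` times that of `B`. -/
def FormalBall.scaled {F : Type*} [Field F] [Fintype F] {m n : ℕ} (B : FormalBall F m n) (γ : ℝ) :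
    Set (FormalBall F m n) :=
  {B' | B'.Sub B ∧ B'.radius = γ * B.radius}

/-- A strategy for White: the next ball of White, as a function of the list of the balls that Black
has chosen so far (White's own earlier balls are determined by it). -/
abbrev Strategy (F : Type*) [Field F] [Fintype F] (m n : ℕ) :=
  List (FormalBall F m n) → FormalBall F m n

/-- White's ball at round `t` (counted from `0`) when White follows the strategy `s` and Black
plays `b 0, b 1, …`. -/
def Strategy.move {F : Type*} [Field F] [Fintype F] {m n : ℕ} (s : Strategy F m n)
    (b : ℕ → FormalBall F m n) (t : ℕ) : FormalBall F m n :=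
  s ((List.range (t + 1)).map b)

/-- White can always win the `(α, β; S)`-game, in which Black starts with a ball of positive radius:
she has a strategy whose moves are legal as long as Black has played legally, and which forces
the intersection of the balls to lie in `S` in every infinite play. -/
def IsWinning {F : Type*} [Field F] [Fintype F] {m n : ℕ} (α β : ℝ)
    (S : Set (Matrix (Fin m) (Fin n) (Series F))) : Prop :=
  ∃ s : Strategy F m n, ∀ b : ℕ → FormalBall F m n, 0 < (b 0).radius →
    (∀ t, (∀ i < t, b (i + 1) ∈ (s.move b i).scaled β) → s.move b t ∈ (b t).scaled α) ∧
    ((∀ i, b (i + 1) ∈ (s.move b i).scaled β) → (⋂ i, (b i).toSet) ⊆ S)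

/-- `S` is `α`-winning. -/
def IsAlphaWinning {F : Type*} [Field F] [Fintype F] {m n : ℕ} (α : ℝ)
    (S : Set (Matrix (Fin m) (Fin n) (Series F))) : Prop :=
  ∀ β : ℝ, 0 < β → β < 1 → IsWinning α β S

open Classical in
/-- The winning dimension of `S`. -/
noncomputable def windim {F : Type*} [Field F] [Fintype F] {m n : ℕ}
    (S : Set (Matrix (Fin m) (Fin n) (Series F))) : ℝ :=
  if {α : ℝ | 0 < α ∧ α < 1 ∧ IsAlphaWinning α S} = ∅ then 0
  else sSup {α : ℝ | 0 < α ∧ α < 1 ∧ IsAlphaWinning α S}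

/-- The vectors `y₁, …, y_m` of `𝓛^{m+n}` are orthonormal, in the sense of the ultrametric norm:
`‖t₁ y₁ + ⋯ + t_m y_m‖ = max |tᵢ|` for all scalars `tᵢ`. Every system of vectors of height at most
`1` with `yᵢ · yⱼ = δᵢⱼ` is of this kind. -/
def IsOrthonormal {F : Type*} [Field F] [Fintype F] {m n : ℕ}
    (y : Fin m → (Fin n ⊕ Fin m → Series F)) : Prop :=
  ∀ t : Fin m → Series F, height (∑ i, t i • y i) = height t

/-- The matrix `[[Aᵀ, I_n], [I_m, 0]]`. -/
noncomputable def starMat {F : Type*} [Field F] {m n : ℕ} (A : Matrix (Fin m) (Fin n) (Series F)) :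
    Matrix (Fin n ⊕ Fin m) (Fin m ⊕ Fin n) (Series F) :=
  Matrix.fromBlocks Aᵀ 1 1 0

/-- The `m × m` matrix of the products of the `yᵢ` with the first `m` columns of `starMat A`. -/
noncomputable def gameMat {F : Type*} [Field F] {m n : ℕ} (y : Fin m → (Fin n ⊕ Fin m → Series F))
    (A : Matrix (Fin m) (Fin n) (Series F)) : Matrix (Fin m) (Fin m) (Series F) :=
  Matrix.of fun i j => y i ⬝ᵥ (starMat A).col (Sum.inl j)

/-- White can win the finite game with data `y`, `B`, `μ`, `α`, `β`: the players follow the rules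
of the `(α, β)`-game from Black's first ball `B`, and the game ends with the first ball of Black of
radius less than `μ ρ(B)`; White wins if, on that ball, the determinant `D` of `gameMat y A`
satisfies `|D| > ρ(B) μ max |D_{l,l'}|`, where `D_{l,l'}` are its cofactors. -/
def WinsFiniteGame {F : Type*} [Field F] [Fintype F] {m n : ℕ} (α β μ : ℝ)
    (y : Fin m → (Fin n ⊕ Fin m → Series F)) (B : FormalBall F m n) : Prop :=
  ∃ s : Strategy F m n, ∀ b : ℕ → FormalBall F m n, b 0 = B → ∀ t,
    (∀ i < t, μ * B.radius ≤ (b i).radius ∧ b (i + 1) ∈ (s.move b i).scaled β) →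
    (μ * B.radius ≤ (b t).radius → s.move b t ∈ (b t).scaled α) ∧
    ((b t).radius < μ * B.radius → ∀ A ∈ (b t).toSet,
      B.radius * μ * height (fun p : Fin m × Fin m => (gameMat y A).adjugate p.1 p.2) <
        absL (gameMat y A).det)

end BadApprox

/-! In a ball of radius ρ White can shift one matrix entry by an element of absolute value k^J, the
largest power of k not exceeding (1-α)ρ, so that k^J > (1-α)ρ/k. The hypothesis on α and β says
α(1-β) < (1-α)/k. Hence a displacement of Black, at most (1-β)αρ, is strictly smaller than k^J. By
the ultrametric inequality so is the sum of any number of later ones, provided White keeps Black's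
centre meanwhile. Black can therefore never undo the shift (`exists_blockStrategy`).

Both games rest on one induction (`Secured.exists_shift`, `exists_secured_of_moves`). Let V have
dimension at most |κ|, and let the forms (x, y) ↦ xA + y be bounded below on a subspace W of V. If a
unit vector u of V is shrunk too much, some functional f kills the image of W. Shifting one entry of
A makes f large at the image of u, and the forms become bounded below on W + span u, with a smaller
constant. After |κ| well spaced moves they are bounded below on all of V.

In the finite game V is the span of the orthonormal vectors and the forms are those of the
transposed matrix. A lower bound on V is a lower bound for u ↦ u G, with G the game matrix, and it
controls the cofactors by the determinant (`le_absL_det`).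

For 𝔅(m,n) the space V is spanned by the integral vectors (q, p) in a window ‖q‖ < k^u, ‖qA + p‖ <
k^(-v). The induction needs dim V ≤ n. This is a transference principle: n + 1 independent vectors
in the window would give, by comparing the two kernels of a block Hankel matrix, a too good
approximation for the transpose (`exists_int_transpose`, `Guarded.finrank_span_windowVectors_le`).
White therefore works alternately on the transpose and on A, each phase using what the preceding one
secured for the other matrix (`guarded_advance`, `guarded_of_alternatingShift`). -/

namespace BadApprox

/-! ### The ultrametric absolute value on Laurent series. -/

section AbsoluteValue

variable {F : Type*} [Field F] [Fintype F]

variable (F) in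
theorem one_lt_cardF : (1 : ℝ) < (Fintype.card F : ℝ) := by
  exact_mod_cast Fintype.one_lt_card

variable (F) in
theorem cardF_pos : (0 : ℝ) < (Fintype.card F : ℝ) := zero_lt_one.trans (one_lt_cardF F)

theorem absL_zero : absL (0 : Series F) = 0 := by simp [absL]

theorem absL_of_ne_zero {x : Series F} (hx : x ≠ 0) :
    absL x = (Fintype.card F : ℝ) ^ (-x.order) := by simp [absL, hx]

theorem absL_pos {x : Series F} (hx : x ≠ 0) : 0 < absL x := by
  rw [absL_of_ne_zero hx]
  exact zpow_pos (cardF_pos F) _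

theorem absL_nonneg (x : Series F) : 0 ≤ absL x := by
  by_cases hx : x = 0
  · simp [hx, absL_zero]
  · exact (absL_pos hx).le

theorem absL_eq_zero {x : Series F} : absL x = 0 ↔ x = 0 :=
  ⟨fun h => by_contra fun hx => (absL_pos hx).ne' h, fun h => by rw [h, absL_zero]⟩

/-- Turns bounds on the absolute value into conditions linear over `F`, which is what allows the
kernel counts of the transference argument. -/
theorem absL_lt_zpow_iff {x : Series F} {z : ℤ} :
    absL x < (Fintype.card F : ℝ) ^ z ↔ ∀ l ≤ -z, x.coeff l = 0 := by
  by_cases hx : x = 0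
  · simp [hx, absL_zero, zpow_pos (cardF_pos F)]
  rw [absL_of_ne_zero hx, zpow_lt_zpow_iff_right₀ (one_lt_cardF F)]
  constructor
  · intro h l hl
    exact HahnSeries.coeff_eq_zero_of_lt_order (by lia)
  · intro h
    by_contra hlt
    exact HahnSeries.coeff_order_eq_zero.not.mpr hx (h x.order (by lia))

theorem absL_neg (x : Series F) : absL (-x) = absL x := by
  by_cases hx : x = 0
  · simp [hx]
  · rw [absL_of_ne_zero hx, absL_of_ne_zero (neg_ne_zero.mpr hx), HahnSeries.order_neg]

theorem absL_mul (x y : Series F) : absL (x * y) = absL x * absL y := by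
  by_cases hx : x = 0
  · simp [hx, absL_zero]
  by_cases hy : y = 0
  · simp [hy, absL_zero]
  rw [absL_of_ne_zero hx, absL_of_ne_zero hy, absL_of_ne_zero (mul_ne_zero hx hy),
    HahnSeries.order_mul hx hy, neg_add, zpow_add₀ (cardF_pos F).ne']

theorem absL_one : absL (1 : Series F) = 1 := by
  rw [absL_of_ne_zero one_ne_zero, HahnSeries.order_one]; simp

theorem absL_add_le_max (x y : Series F) : absL (x + y) ≤ max (absL x) (absL y) := by
  by_cases hx : x = 0
  · simp [hx]
  by_cases hy : y = 0
  · simp [hy]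
  by_cases hxy : x + y = 0
  · rw [hxy, absL_zero]; exact le_max_of_le_left (absL_nonneg x)
  rw [absL_of_ne_zero hx, absL_of_ne_zero hy, absL_of_ne_zero hxy]
  have h := HahnSeries.min_order_le_order_add hxy
  rcases min_le_iff.mp h with h | h
  · exact le_max_of_le_left (zpow_le_zpow_right₀ (one_lt_cardF F).le (neg_le_neg h))
  · exact le_max_of_le_right (zpow_le_zpow_right₀ (one_lt_cardF F).le (neg_le_neg h))

theorem absL_add_lt {x y : Series F} {r : ℝ} (hx : absL x < r) (hy : absL y < r) :
    absL (x + y) < r :=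
  (absL_add_le_max x y).trans_lt (max_lt hx hy)

theorem absL_add_le {x y : Series F} {r : ℝ} (hx : absL x ≤ r) (hy : absL y ≤ r) :
    absL (x + y) ≤ r :=
  (absL_add_le_max x y).trans (max_le hx hy)

/-- A perturbation of smaller absolute value does not destroy a lower bound. -/
theorem le_absL_add {x y : Series F} {r : ℝ} (hx : r ≤ absL x) (hy : absL y < r) :
    r ≤ absL (x + y) := by
  by_contra! h
  have := absL_add_lt h ((absL_neg y).trans_lt hy)
  rw [add_neg_cancel_right] at this
  exact absurd this hx.not_gt

theorem absL_sum_le {ι : Type*} (s : Finset ι) (f : ι → Series F) {r : ℝ} (hr : 0 ≤ r)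
    (h : ∀ i ∈ s, absL (f i) ≤ r) : absL (∑ i ∈ s, f i) ≤ r :=
  Finset.sum_induction f (fun x => absL x ≤ r) (fun _ _ => absL_add_le) (by simpa [absL_zero]) h

theorem absL_single (z : ℤ) : absL (HahnSeries.single (-z) (1 : F)) = (Fintype.card F : ℝ) ^ z := by
  rw [absL_of_ne_zero (by simp), HahnSeries.order_single one_ne_zero, neg_neg]

end AbsoluteValue

/-! ### Sup norms of vectors and matrices. -/

section Height

variable {F : Type*} [Field F] [Fintype F] {ι κ : Type*} [Fintype ι] [Fintype κ]

theorem absL_le_height (x : ι → Series F) (i : ι) : absL (x i) ≤ height x :=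
  le_ciSup (f := fun i => absL (x i)) (Set.finite_range _).bddAbove i

theorem height_nonneg (x : ι → Series F) : 0 ≤ height x :=
  Real.iSup_nonneg fun _ => absL_nonneg _

theorem height_le_iff {x : ι → Series F} {r : ℝ} (hr : 0 ≤ r) :
    height x ≤ r ↔ ∀ i, absL (x i) ≤ r :=
  ⟨fun h i => (absL_le_height x i).trans h, fun h => Real.iSup_le h hr⟩

theorem exists_height_eq [Nonempty ι] (x : ι → Series F) : ∃ i, absL (x i) = height x :=
  exists_eq_ciSup_of_finite

theorem height_lt_iff {x : ι → Series F} {r : ℝ} (hr : 0 < r) :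
    height x < r ↔ ∀ i, absL (x i) < r := by
  refine ⟨fun h i => (absL_le_height x i).trans_lt h, fun h => ?_⟩
  cases isEmpty_or_nonempty ι
  · simpa [height, Real.iSup_of_isEmpty] using hr
  · obtain ⟨i, hi⟩ := exists_height_eq x
    rw [← hi]; exact h i

theorem height_zero : height (0 : ι → Series F) = 0 :=
  le_antisymm ((height_le_iff le_rfl).mpr fun i => by simp [absL_zero]) (height_nonneg _)

theorem height_eq_zero {x : ι → Series F} : height x = 0 ↔ x = 0 := by
  refine ⟨fun h => funext fun i => absL_eq_zero.mp ?_, fun h => by rw [h, height_zero]⟩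
  exact le_antisymm (h ▸ absL_le_height x i) (absL_nonneg _)

theorem height_pos {x : ι → Series F} (hx : x ≠ 0) : 0 < height x :=
  (height_nonneg x).lt_of_ne fun h => hx (height_eq_zero.mp h.symm)

theorem height_neg (x : ι → Series F) : height (-x) = height x := by
  simp [height, absL_neg]

theorem height_smul (t : Series F) (x : ι → Series F) : height (t • x) = absL t * height x := by
  simp only [height, Pi.smul_apply, smul_eq_mul, absL_mul]
  exact (Real.mul_iSup_of_nonneg (absL_nonneg t) _).symm

theorem height_add_le_max (x y : ι → Series F) : height (x + y) ≤ max (height x) (height y) :=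
  (height_le_iff (le_max_of_le_left (height_nonneg x))).mpr fun i =>
    (absL_add_le_max _ _).trans (max_le_max (absL_le_height x i) (absL_le_height y i))

theorem height_add_lt {x y : ι → Series F} {r : ℝ} (hx : height x < r) (hy : height y < r) :
    height (x + y) < r :=
  (height_add_le_max x y).trans_lt (max_lt hx hy)

theorem height_add_le {x y : ι → Series F} {r : ℝ} (hx : height x ≤ r) (hy : height y ≤ r) :
    height (x + y) ≤ r :=
  (height_add_le_max x y).trans (max_le hx hy)

theorem le_height_add {x y : ι → Series F} {r : ℝ} (hx : r ≤ height x) (hy : height y < r) :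
    r ≤ height (x + y) := by
  by_contra! h
  have := height_add_lt h ((height_neg y).trans_lt hy)
  rw [add_neg_cancel_right] at this
  exact absurd this hx.not_gt

theorem absL_dotProduct_le (x y : ι → Series F) : absL (x ⬝ᵥ y) ≤ height x * height y :=
  absL_sum_le _ _ (mul_nonneg (height_nonneg x) (height_nonneg y)) fun i _ => by
    rw [absL_mul]
    exact mul_le_mul (absL_le_height x i) (absL_le_height y i) (absL_nonneg _) (height_nonneg x)

theorem height_comp_le (x : ι → Series F) (f : κ → ι) : height (fun j => x (f j)) ≤ height x :=
  (height_le_iff (height_nonneg x)).mpr fun j => absL_le_height x (f j)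

/-- The height of a matrix with arbitrary index types. -/
noncomputable def entryHeight (A : Matrix ι κ (Series F)) : ℝ :=
  height (fun p : ι × κ => A p.1 p.2)

theorem absL_le_entryHeight (A : Matrix ι κ (Series F)) (i : ι) (j : κ) :
    absL (A i j) ≤ entryHeight A :=
  absL_le_height (fun p : ι × κ => A p.1 p.2) (i, j)

theorem entryHeight_nonneg (A : Matrix ι κ (Series F)) : 0 ≤ entryHeight A := height_nonneg _

theorem entryHeight_le_iff {A : Matrix ι κ (Series F)} {r : ℝ} (hr : 0 ≤ r) :
    entryHeight A ≤ r ↔ ∀ i j, absL (A i j) ≤ r := by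
  rw [entryHeight, height_le_iff hr, Prod.forall]

theorem entryHeight_zero : entryHeight (0 : Matrix ι κ (Series F)) = 0 := height_zero

theorem entryHeight_add_le {A B : Matrix ι κ (Series F)} {r : ℝ} (hA : entryHeight A ≤ r)
    (hB : entryHeight B ≤ r) : entryHeight (A + B) ≤ r := height_add_le hA hB

theorem entryHeight_transpose (A : Matrix ι κ (Series F)) : entryHeight Aᵀ = entryHeight A :=
  le_antisymm
    ((entryHeight_le_iff (entryHeight_nonneg A)).mpr fun i j => absL_le_entryHeight A j i)
    ((entryHeight_le_iff (entryHeight_nonneg Aᵀ)).mpr fun i j => absL_le_entryHeight Aᵀ j i)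

theorem matHeight_eq {m n : ℕ} (A : Matrix (Fin m) (Fin n) (Series F)) :
    matHeight A = entryHeight A := rfl

theorem height_vecMul_le (x : ι → Series F) (A : Matrix ι κ (Series F)) :
    height (x ᵥ* A) ≤ height x * entryHeight A :=
  (height_le_iff (mul_nonneg (height_nonneg x) (entryHeight_nonneg A))).mpr fun j =>
    (absL_dotProduct_le x fun i => A i j).trans <| mul_le_mul_of_nonneg_left
      ((height_le_iff (entryHeight_nonneg A)).mpr fun i => absL_le_entryHeight A i j)
      (height_nonneg x)

end Height

/-! ### The linear map (x, y) ↦ xA + y. -/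

section AffineForms

variable {F : Type*} [Field F] {ι κ : Type*} [Fintype ι]

/-- The affine forms `(x, y) ↦ x A + y` attached to a matrix `A`. -/
noncomputable def affineForms (A : Matrix ι κ (Series F)) :
    (ι ⊕ κ → Series F) →ₗ[Series F] (κ → Series F) where
  toFun z := (fun i => z (Sum.inl i)) ᵥ* A + fun j => z (Sum.inr j)
  map_add' z z' := by
    have : (fun i => (z + z') (Sum.inl i)) = (fun i => z (Sum.inl i)) + fun i => z' (Sum.inl i) :=
      rfl
    rw [this, Matrix.add_vecMul]
    funext j
    simp only [Pi.add_apply]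
    ring
  map_smul' t z := by
    have : (fun i => (t • z) (Sum.inl i)) = t • (fun i => z (Sum.inl i)) := rfl
    rw [this, Matrix.smul_vecMul]
    funext j
    simp [mul_add]

theorem affineForms_apply (A : Matrix ι κ (Series F)) (z : ι ⊕ κ → Series F) :
    affineForms A z = (fun i => z (Sum.inl i)) ᵥ* A + fun j => z (Sum.inr j) := rfl

theorem affineForms_add (A B : Matrix ι κ (Series F)) (z : ι ⊕ κ → Series F) :
    affineForms (A + B) z = affineForms A z + (fun i => z (Sum.inl i)) ᵥ* B := by
  rw [affineForms_apply, affineForms_apply, Matrix.vecMul_add]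
  abel

end AffineForms

/-! ### Raising the dimension of a subspace on which the forms are bounded below. -/

section Secured

variable {F : Type*} [Field F] [Fintype F] {ι κ : Type*} [Fintype ι] [Fintype κ]

theorem height_inl_vecMul_le (B : Matrix ι κ (Series F)) (z : ι ⊕ κ → Series F) :
    height ((fun i => z (Sum.inl i)) ᵥ* B) ≤ height z * entryHeight B :=
  (height_vecMul_le _ B).trans <|
    mul_le_mul_of_nonneg_right (height_comp_le z Sum.inl) (entryHeight_nonneg B)

/-- On a subspace of `V` of dimension at least `v` (or on all of `V`) the affine forms of `A` do
not shrink vectors by more than the factor `r`. -/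
def Secured (V : Submodule (Series F) (ι ⊕ κ → Series F)) (A : Matrix ι κ (Series F)) (v : ℕ)
    (r : ℝ) : Prop :=
  ∃ W ≤ V, (v ≤ Module.finrank (Series F) W ∨ W = V) ∧
    ∀ w ∈ W, r * height w ≤ height (affineForms A w)

theorem le_height_affineForms_add {A B : Matrix ι κ (Series F)} {w : ι ⊕ κ → Series F} {r : ℝ}
    (h : r * height w ≤ height (affineForms A w)) (hB : entryHeight B < r) :
    r * height w ≤ height (affineForms (A + B) w) := by
  by_cases hw : w = 0
  · simp [hw, height_zero]
  rw [affineForms_add]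
  refine le_height_add h ((height_inl_vecMul_le B w).trans_lt ?_)
  rw [mul_comm]
  exact mul_lt_mul_of_pos_right hB (height_pos hw)

/-- A nonzero functional vanishing on the proper subspace `S`, divided by its coefficient of largest
absolute value. -/
theorem exists_dotProduct_eq_zero (S : Submodule (Series F) (κ → Series F))
    (hS : Module.finrank (Series F) S < Fintype.card κ) :
    ∃ (f : κ → Series F) (j : κ), f j = 1 ∧ height f = 1 ∧ ∀ x ∈ S, x ⬝ᵥ f = 0 := by
  classical
  have hlt : S < ⊤ := by
    refine lt_top_iff_ne_top.mpr fun h => ?_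
    rw [h, finrank_top, Module.finrank_fintype_fun_eq_card] at hS
    exact lt_irrefl _ hS
  obtain ⟨φ, hφ, hle⟩ := Submodule.exists_le_ker_of_lt_top S hlt
  set g : κ → Series F := fun j => φ (Pi.single j 1) with hg
  have hφg : ∀ x, φ x = x ⬝ᵥ g := fun x => by
    rw [LinearMap.pi_apply_eq_sum_univ φ x]
    simp only [dotProduct, hg, smul_eq_mul]
    refine Finset.sum_congr rfl fun j _ => ?_
    congr 2
    funext i
    simp [Pi.single_apply, eq_comm]
  have hg0 : g ≠ 0 := fun h => hφ (LinearMap.ext fun x => by rw [hφg, h]; simp)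
  have : Nonempty κ := by
    obtain ⟨j, -⟩ := Function.ne_iff.mp hg0
    exact ⟨j⟩
  obtain ⟨j, hj⟩ := exists_height_eq g
  have hgj : g j ≠ 0 := fun h => hg0 (height_eq_zero.mp (by rw [← hj, h, absL_zero]))
  refine ⟨(g j)⁻¹ • g, j, ?_, ?_, fun x hx => ?_⟩
  · simp [hgj]
  · rw [height_smul, ← hj, ← absL_mul, inv_mul_cancel₀ hgj, absL_one]
  · rw [dotProduct_smul, ← hφg, LinearMap.mem_ker.mp (hle hx), smul_zero]

/-- If the first block of `u` were below `c`, its product with `A` would have height below 1. So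
would the second block, as a difference of two such vectors, against `height u = 1`. Thus a nearly
annihilated `u` has a first block on which changes of `A` act. -/
theorem le_height_inl {A : Matrix ι κ (Series F)} {u : ι ⊕ κ → Series F} {c : ℝ} (hc : c ≤ 1)
    (hA : c * entryHeight A ≤ 1) (hu : height u = 1) (hAu : height (affineForms A u) < 1) :
    c ≤ height fun i => u (Sum.inl i) := by
  by_contra! h
  have h1 : height ((fun i => u (Sum.inl i)) ᵥ* A) < 1 := by
    rcases (entryHeight_nonneg A).eq_or_lt with h0 | h0
    · refine (height_vecMul_le _ A).trans_lt ?_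
      rw [← h0]; simp
    · exact (height_vecMul_le _ A).trans_lt ((mul_lt_mul_of_pos_right h h0).trans_le hA)
  have h2 : height (fun j => u (Sum.inr j)) < 1 := by
    have : (fun j => u (Sum.inr j)) = affineForms A u + -((fun i => u (Sum.inl i)) ᵥ* A) := by
      rw [affineForms_apply]; abel
    rw [this]
    exact height_add_lt hAu (by rwa [height_neg])
  refine hu.not_lt ((height_lt_iff one_pos).mpr ?_)
  rintro (i | j)
  · exact (absL_le_height (fun i => u (Sum.inl i)) i).trans_lt (h.trans_le hc)
  · exact (absL_le_height (fun j => u (Sum.inr j)) j).trans_lt h2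

/-- A change of one entry of size at most `k ^ J` makes a given affine form large, robustly. -/
theorem exists_shift_le_absL (u : ι → Series F) (hu : 0 < height u) (f : κ → Series F) (j : κ)
    (hfj : f j = 1) (hf : height f = 1) (x : Series F) (J : ℤ) :
    ∃ E : Matrix ι κ (Series F), entryHeight E ≤ (Fintype.card F : ℝ) ^ J ∧
      ∀ G : Matrix ι κ (Series F), entryHeight G < (Fintype.card F : ℝ) ^ J →
        height u * (Fintype.card F : ℝ) ^ J ≤ absL (x + (u ᵥ* (E + G)) ⬝ᵥ f) := by
  classical
  have hJ : 0 < (Fintype.card F : ℝ) ^ J := zpow_pos (cardF_pos F) J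
  have hG : ∀ G : Matrix ι κ (Series F), entryHeight G < (Fintype.card F : ℝ) ^ J →
      absL ((u ᵥ* G) ⬝ᵥ f) < height u * (Fintype.card F : ℝ) ^ J := fun G hG => by
    refine (absL_dotProduct_le _ f).trans_lt ?_
    rw [hf, mul_one]
    exact (height_vecMul_le u G).trans_lt (mul_lt_mul_of_pos_left hG hu)
  suffices ∃ E : Matrix ι κ (Series F), entryHeight E ≤ (Fintype.card F : ℝ) ^ J ∧
      height u * (Fintype.card F : ℝ) ^ J ≤ absL (x + (u ᵥ* E) ⬝ᵥ f) by
    obtain ⟨E, hE, hE'⟩ := this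
    refine ⟨E, hE, fun G hG' => ?_⟩
    rw [Matrix.vecMul_add, add_dotProduct, ← add_assoc]
    exact le_absL_add hE' (hG G hG')
  -- If the form is already large no shift is needed. Otherwise the entry shifted is in the row
  -- where `u` is largest and in the column where `f` equals 1.
  by_cases hx : height u * (Fintype.card F : ℝ) ^ J ≤ absL x
  · exact ⟨0, by rw [entryHeight_zero]; exact hJ.le, by simpa using hx⟩
  have : Nonempty ι := by
    by_contra h
    rw [not_nonempty_iff] at h
    simp [height, Real.iSup_of_isEmpty] at hu
  obtain ⟨l, hl⟩ := exists_height_eq u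
  refine ⟨Matrix.single l j (HahnSeries.single (-J) 1), ?_, ?_⟩
  · refine (entryHeight_le_iff hJ.le).mpr fun a b => ?_
    rw [Matrix.single_apply]
    split_ifs
    · exact (absL_single J).le
    · rw [absL_zero]; exact hJ.le
  · have : (u ᵥ* Matrix.single l j (HahnSeries.single (-J) (1 : F))) ⬝ᵥ f =
        u l * HahnSeries.single (-J) (1 : F) := by
      rw [← Matrix.dotProduct_mulVec, Matrix.single_mulVec]
      simp [hfj, Function.update_apply, dotProduct]
    rw [this, add_comm]
    refine le_absL_add ?_ (not_le.mp hx)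
    rw [absL_mul, absL_single, hl]

/-- One move of White raises the dimension of the secured subspace. -/
theorem Secured.exists_shift {V : Submodule (Series F) (ι ⊕ κ → Series F)}
    (hV : Module.finrank (Series F) V ≤ Fintype.card κ) {A : Matrix ι κ (Series F)} {v : ℕ}
    {r c : ℝ} {J : ℤ} (hc : 0 < c) (hc1 : c ≤ 1) (hA : c * entryHeight A ≤ 1) (hr : c * r ≤ 1)
    (hJ : (Fintype.card F : ℝ) ^ J < c * r) (h : Secured V A v r) :
    ∃ E : Matrix ι κ (Series F), entryHeight E ≤ (Fintype.card F : ℝ) ^ J ∧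
      ∀ G : Matrix ι κ (Series F), entryHeight G < (Fintype.card F : ℝ) ^ J →
        Secured V (A + (E + G)) (v + 1) (c * (Fintype.card F : ℝ) ^ J) := by
  obtain ⟨W, hWV, hdim, hW⟩ := h
  set q : ℝ := (Fintype.card F : ℝ) ^ J with hq
  have hq0 : 0 < q := zpow_pos (cardF_pos F) J
  have hr0 : 0 < r := pos_of_mul_pos_right (hq0.trans hJ) hc.le
  have hcr : c * r ≤ r := mul_le_of_le_one_left hr0.le hc1
  have hcq : c * q ≤ q := mul_le_of_le_one_left hq0.le hc1
  -- If all of `V` is already secured, the zero shift works and the second alternative in `Secured`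
  -- takes over from the dimension count.
  by_cases hall : ∀ u ∈ V, c * r * height u ≤ height (affineForms A u)
  · refine ⟨0, by rw [entryHeight_zero]; exact hq0.le, fun G hG =>
      ⟨V, le_rfl, Or.inr rfl, fun w hw => ?_⟩⟩
    rw [zero_add]
    refine (mul_le_mul_of_nonneg_right (hcq.trans hJ.le) (height_nonneg w)).trans ?_
    exact le_height_affineForms_add (hall w hw) (hG.trans hJ)
  push Not at hall
  obtain ⟨u, huV, hu, hAu⟩ : ∃ u ∈ V, height u = 1 ∧ height (affineForms A u) < c * r := by
    obtain ⟨u, huV, hu⟩ := hall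
    have hu0 : u ≠ 0 := by
      rintro rfl
      simp [height_zero] at hu
    have : Nonempty (ι ⊕ κ) := by
      obtain ⟨j, -⟩ := Function.ne_iff.mp hu0
      exact ⟨j⟩
    obtain ⟨i, hi⟩ := exists_height_eq u
    have hpos := height_pos hu0
    have hi0 : u i ≠ 0 := fun h => by rw [← hi, h, absL_zero] at hpos; exact lt_irrefl _ hpos
    have hinv : absL (u i)⁻¹ * height u = 1 := by
      rw [← hi, ← absL_mul, inv_mul_cancel₀ hi0, absL_one]
    refine ⟨(u i)⁻¹ • u, V.smul_mem _ huV, by rw [height_smul, hinv], ?_⟩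
    rw [map_smul, height_smul]
    calc absL (u i)⁻¹ * height (affineForms A u)
        < absL (u i)⁻¹ * (c * r * height u) :=
          mul_lt_mul_of_pos_left hu (absL_pos (inv_ne_zero hi0))
      _ = c * r * (absL (u i)⁻¹ * height u) := by ring
      _ = c * r := by rw [hinv, mul_one]
  have huW : u ∉ W := fun hmem => by
    have := hW u hmem
    rw [hu, mul_one] at this
    exact absurd (this.trans_lt (hAu.trans_le hcr)) (lt_irrefl _)
  have hWlt : W < V := lt_of_le_of_ne hWV fun h => huW (h ▸ huV)
  have hv : v ≤ Module.finrank (Series F) W := hdim.resolve_right hWlt.ne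
  have hmap : Module.finrank (Series F) (W.map (affineForms A)) < Fintype.card κ :=
    (Submodule.finrank_map_le _ _).trans_lt
      ((Submodule.finrank_lt_finrank_of_lt hWlt).trans_le hV)
  obtain ⟨f, j, hfj, hf, hfW⟩ := exists_dotProduct_eq_zero _ hmap
  have hcu : c ≤ height fun i => u (Sum.inl i) := le_height_inl hc1 hA hu (hAu.trans_le hr)
  obtain ⟨E, hE, hEG⟩ := exists_shift_le_absL _ (hc.trans_le hcu) f j hfj hf
    (affineForms A u ⬝ᵥ f) J
  refine ⟨E, hE, fun G hG => ⟨W ⊔ Submodule.span _ {u}, sup_le hWV ?_, Or.inl ?_, ?_⟩⟩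
  · rwa [Submodule.span_singleton_le_iff_mem]
  · have hlt : W < W ⊔ Submodule.span (Series F) {u} := by
      refine lt_of_le_of_ne le_sup_left fun h => huW ?_
      rw [h]
      exact Submodule.mem_sup_right (Submodule.mem_span_singleton_self u)
    exact hv.trans_lt (Submodule.finrank_lt_finrank_of_lt hlt)
  intro z hz
  obtain ⟨w, hw, z', hz', rfl⟩ := Submodule.mem_sup.mp hz
  obtain ⟨t, rfl⟩ := Submodule.mem_span_singleton.mp hz'
  have hEG' : entryHeight (E + G) ≤ q := entryHeight_add_le hE hG.le
  have htu : height (t • u) = absL t := by rw [height_smul, hu, mul_one]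
  -- If `w` dominates, the bound on `W` survives, since both the form of `t • u` and the
  -- perturbation are below `r * height w`. Otherwise `f`, which kills the image of `w` under `A`,
  -- isolates the contribution of `t • u`.
  rcases le_or_gt (c * absL t) (height w) with hcase | hcase
  · by_cases hw0 : w = 0
    · have : t = 0 := by
        rw [hw0, height_zero] at hcase
        exact absL_eq_zero.mp (le_antisymm (nonpos_of_mul_nonpos_right hcase hc) (absL_nonneg t))
      simp [hw0, this, height_zero]
    have hwpos := height_pos hw0
    have hz : c * height (w + t • u) ≤ height w := by
      refine (mul_le_mul_of_nonneg_left (height_add_le_max _ _) hc.le).trans ?_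
      rw [htu, mul_max_of_nonneg _ _ hc.le]
      exact max_le (mul_le_of_le_one_left hwpos.le hc1) hcase
    have hrw : r * height w ≤ height (affineForms (A + (E + G)) (w + t • u)) := by
      rw [affineForms_add, map_add, add_assoc]
      refine le_height_add (hW w hw) (height_add_lt ?_ ?_)
      · rw [map_smul, height_smul]
        rcases (absL_nonneg t).eq_or_lt with ht | ht
        · rw [← ht, zero_mul]; exact mul_pos hr0 hwpos
        · calc absL t * height (affineForms A u) < absL t * (c * r) :=
                mul_lt_mul_of_pos_left hAu ht
            _ = r * (c * absL t) := by ring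
            _ ≤ r * height w := mul_le_mul_of_nonneg_left hcase hr0.le
      · have h1 : height (w + t • u) * entryHeight (E + G) ≤ height (w + t • u) * q :=
          mul_le_mul_of_nonneg_left hEG' (height_nonneg _)
        refine (height_inl_vecMul_le _ _).trans_lt (h1.trans_lt ?_)
        refine lt_of_mul_lt_mul_left (a := c) ?_ hc.le
        calc c * (height (w + t • u) * q) = (c * height (w + t • u)) * q := by ring
          _ ≤ height w * q := mul_le_mul_of_nonneg_right hz hq0.le
          _ < height w * (c * r) := mul_lt_mul_of_pos_left hJ hwpos
          _ = c * (r * height w) := by ring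
    calc c * q * height (w + t • u) = q * (c * height (w + t • u)) := by ring
      _ ≤ q * height w := mul_le_mul_of_nonneg_left hz hq0.le
      _ ≤ r * height w := mul_le_mul_of_nonneg_right (hJ.le.trans hcr) hwpos.le
      _ ≤ _ := hrw
  · have ht : 0 < absL t := pos_of_mul_pos_right ((height_nonneg w).trans_lt hcase) hc.le
    have hz : height (w + t • u) ≤ absL t :=
      height_add_le (hcase.le.trans (mul_le_of_le_one_left ht.le hc1)) htu.le
    have hdot : affineForms (A + (E + G)) (w + t • u) ⬝ᵥ f =
        t * (affineForms A u ⬝ᵥ f + ((fun i => u (Sum.inl i)) ᵥ* (E + G)) ⬝ᵥ f) +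
          ((fun i => w (Sum.inl i)) ᵥ* (E + G)) ⬝ᵥ f := by
      rw [map_add, map_smul, affineForms_add, affineForms_add, add_dotProduct, smul_dotProduct,
        add_dotProduct, add_dotProduct, hfW _ (Submodule.mem_map_of_mem hw), smul_eq_mul]
      ring
    have hfin : absL t * (c * q) ≤ absL (affineForms (A + (E + G)) (w + t • u) ⬝ᵥ f) := by
      rw [hdot]
      refine le_absL_add ?_ ?_
      · rw [absL_mul]
        exact mul_le_mul_of_nonneg_left
          ((mul_le_mul_of_nonneg_right hcu hq0.le).trans (hEG G hG)) ht.le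
      · refine (absL_dotProduct_le _ _).trans_lt ?_
        rw [hf, mul_one]
        have h1 : height w * entryHeight (E + G) ≤ height w * q :=
          mul_le_mul_of_nonneg_left hEG' (height_nonneg _)
        refine (height_inl_vecMul_le _ _).trans_lt (h1.trans_lt ?_)
        calc height w * q < c * absL t * q := mul_lt_mul_of_pos_right hcase hq0
          _ = absL t * (c * q) := by ring
    calc c * q * height (w + t • u) ≤ c * q * absL t :=
          mul_le_mul_of_nonneg_left hz (mul_pos hc hq0).le
      _ = absL t * (c * q) := mul_comm _ _
      _ ≤ _ := hfin
      _ ≤ _ := absL_dotProduct_le _ _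
      _ = _ := by rw [hf, mul_one]

end Secured

/-! ### Legal strategies in which White shifts the centre once every `N` rounds. -/

section BlockGame

variable {F : Type*} [Field F] [Fintype F] {m n : ℕ}

variable (F) in
/-- The largest exponent `J` for which White may move the centre of a ball of radius `ρ` by
`k ^ J`. -/
noncomputable def moveExp (α ρ : ℝ) : ℤ := Int.log (Fintype.card F) ((1 - α) * ρ)

theorem zpow_moveExp_le {α ρ : ℝ} (hα : α < 1) (hρ : 0 < ρ) :
    (Fintype.card F : ℝ) ^ moveExp F α ρ ≤ (1 - α) * ρ :=
  Int.zpow_log_le_self Fintype.one_lt_card (mul_pos (sub_pos.mpr hα) hρ)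

theorem lt_zpow_moveExp (F : Type*) [Field F] [Fintype F] (α ρ : ℝ) :
    (1 - α) * ρ < (Fintype.card F : ℝ) ^ moveExp F α ρ * Fintype.card F := by
  have h := Int.lt_zpow_succ_log_self (Fintype.one_lt_card (α := F)) ((1 - α) * ρ)
  rwa [zpow_add_one₀ (cardF_pos F).ne'] at h

theorem matHeight_sub_le {A B C : Matrix (Fin m) (Fin n) (Series F)} {r : ℝ}
    (h : matHeight (A - B) ≤ r) (h' : matHeight (B - C) ≤ r) : matHeight (A - C) ≤ r := by
  rw [← sub_add_sub_cancel A B C]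
  exact height_add_le h h'

theorem matHeight_sub_lt {A B C : Matrix (Fin m) (Fin n) (Series F)} {r : ℝ}
    (h : matHeight (A - B) < r) (h' : matHeight (B - C) < r) : matHeight (A - C) < r := by
  rw [← sub_add_sub_cancel A B C]
  exact height_add_lt h h'

theorem matHeight_sub_self (A : Matrix (Fin m) (Fin n) (Series F)) : matHeight (A - A) = 0 := by
  rw [sub_self]; exact height_zero

theorem FormalBall.matHeight_sub_le_of_mem_scaled {B B' : FormalBall F m n} {γ : ℝ}
    (h : B' ∈ B.scaled γ) : matHeight (B'.center - B.center) ≤ (1 - γ) * B.radius := by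
  have h1 := h.1
  rw [FormalBall.Sub, h.2] at h1
  linarith

/-- The centre that White chooses at time `t`, against Black's balls `b`, when she moves only at the
times `n₀ + N i`, by `E i` applied to the centres of the balls of index `st i` and `i` among those
of Black at these times. -/
noncomputable def blockCenter (N n₀ : ℕ) (st : ℕ → ℕ)
    (E : ℕ → Matrix (Fin m) (Fin n) (Series F) → Matrix (Fin m) (Fin n) (Series F) →
      Matrix (Fin m) (Fin n) (Series F)) (b : ℕ → FormalBall F m n) (t : ℕ) :
    Matrix (Fin m) (Fin n) (Series F) :=
  (b t).center + if n₀ ≤ t ∧ N ∣ t - n₀ then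
    E ((t - n₀) / N) (b (n₀ + N * st ((t - n₀) / N))).center (b t).center else 0

/-- The strategy of White with the centres `blockCenter`. -/
noncomputable def blockStrategy (α : ℝ) (hα : 0 ≤ α) (N n₀ : ℕ) (st : ℕ → ℕ)
    (E : ℕ → Matrix (Fin m) (Fin n) (Series F) → Matrix (Fin m) (Fin n) (Series F) →
      Matrix (Fin m) (Fin n) (Series F)) (B : FormalBall F m n) : Strategy F m n :=
  fun l =>
    { center := blockCenter N n₀ st E (fun i => l.getD i B) (l.length - 1)
      radius := α * (l.getD (l.length - 1) B).radius
      radius_nonneg := mul_nonneg hα (l.getD (l.length - 1) B).radius_nonneg }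

variable {α β : ℝ} {N n₀ : ℕ} {st : ℕ → ℕ}
  {E : ℕ → Matrix (Fin m) (Fin n) (Series F) → Matrix (Fin m) (Fin n) (Series F) →
    Matrix (Fin m) (Fin n) (Series F)} {B : FormalBall F m n}

theorem getD_map_range (b : ℕ → FormalBall F m n) (B : FormalBall F m n) {t i : ℕ} (h : i ≤ t) :
    ((List.range (t + 1)).map b).getD i B = b i := by
  simp [List.getD_eq_getElem?_getD, Nat.lt_succ_of_le h]

theorem blockStrategy_move_radius (hα : 0 ≤ α) (b : ℕ → FormalBall F m n) (t : ℕ) :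
    ((blockStrategy α hα N n₀ st E B).move b t).radius = α * (b t).radius := by
  simp only [Strategy.move, blockStrategy, List.length_map, List.length_range, Nat.add_sub_cancel]
  rw [getD_map_range b B le_rfl]

theorem blockStrategy_move_center (hα : 0 ≤ α) (hst : ∀ i, st i ≤ i) (b : ℕ → FormalBall F m n)
    (t : ℕ) : ((blockStrategy α hα N n₀ st E B).move b t).center = blockCenter N n₀ st E b t := by
  simp only [Strategy.move, blockStrategy, List.length_map, List.length_range, Nat.add_sub_cancel,
    blockCenter]
  rw [getD_map_range b B le_rfl]
  congr 1
  split_ifs with h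
  · rw [getD_map_range b B]
    calc n₀ + N * st ((t - n₀) / N) ≤ n₀ + N * ((t - n₀) / N) := by gcongr; exact hst _
      _ ≤ t := by have := Nat.mul_div_le (t - n₀) N; lia
  · rfl

/-- The last clause is the heart: over a block the centre changes by White's chosen shift plus an
error `G` strictly below the size allowed to such a shift, so Black cannot cancel it. -/
theorem exists_blockStrategy (hα0 : 0 < α) (hα1 : α < 1) (hβ0 : 0 < β) (hβ1 : β < 1)
    (hαβ : 0 < (Fintype.card F : ℝ)⁻¹ + α * β - ((Fintype.card F : ℝ)⁻¹ + 1) * α)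
    (hB : 0 < B.radius) (hN : 0 < N) (hst : ∀ i, st i ≤ i)
    (hE : ∀ i A A', matHeight (E i A A') ≤
      (Fintype.card F : ℝ) ^ moveExp F α ((α * β) ^ (n₀ + N * i) * B.radius)) :
    ∃ s : Strategy F m n, ∀ b : ℕ → FormalBall F m n, b 0 = B → ∀ t,
      (∀ i < t, b (i + 1) ∈ (s.move b i).scaled β) →
      s.move b t ∈ (b t).scaled α ∧ (b t).radius = (α * β) ^ t * B.radius ∧
      (∀ i ≤ t, matHeight ((b t).center - (b i).center) ≤ (b i).radius) ∧
      ∀ i, n₀ + N * (i + 1) ≤ t → ∃ G : Matrix (Fin m) (Fin n) (Series F),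
        matHeight G <
          (Fintype.card F : ℝ) ^ moveExp F α ((α * β) ^ (n₀ + N * i) * B.radius) ∧
        (b (n₀ + N * (i + 1))).center = (b (n₀ + N * i)).center +
          (E i (b (n₀ + N * st i)).center (b (n₀ + N * i)).center + G) := by
  have hab0 : 0 < α * β := mul_pos hα0 hβ0
  have hab1 : α * β < 1 := mul_lt_one_of_nonneg_of_lt_one_left hα0.le hα1 hβ1.le
  have hρ : ∀ t, 0 < (α * β) ^ t * B.radius := fun t => mul_pos (pow_pos hab0 t) hB
  refine ⟨blockStrategy α hα0.le N n₀ st E B, fun b hb0 t ht => ?_⟩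
  have hrad : ∀ i ≤ t, (b i).radius = (α * β) ^ i * B.radius := fun i => by
    induction i with
    | zero => intro _; rw [hb0]; simp
    | succ i ih =>
      intro hi
      rw [(ht i hi).2, blockStrategy_move_radius, ih (by lia)]
      ring
  have hwhite : ∀ i ≤ t, matHeight (((blockStrategy α hα0.le N n₀ st E B).move b i).center -
      (b i).center) ≤ (1 - α) * (b i).radius := fun i hi => by
    rw [blockStrategy_move_center hα0.le hst, blockCenter, add_sub_cancel_left]
    split_ifs with h
    · refine (hE _ _ _).trans ?_
      rw [hrad i hi, Nat.mul_div_cancel' h.2, Nat.add_sub_cancel' h.1]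
      exact zpow_moveExp_le hα1 (hρ i)
    · exact height_zero.trans_le (mul_nonneg (sub_pos.mpr hα1).le (b i).radius_nonneg)
  have hblack : ∀ i < t, matHeight ((b (i + 1)).center -
      ((blockStrategy α hα0.le N n₀ st E B).move b i).center) ≤
        (1 - β) * (α * ((α * β) ^ i * B.radius)) := fun i hi => by
    have := FormalBall.matHeight_sub_le_of_mem_scaled (ht i hi)
    rwa [blockStrategy_move_radius, hrad i hi.le] at this
  have hanti : ∀ i j, i ≤ j → (α * β) ^ j * B.radius ≤ (α * β) ^ i * B.radius := fun i j hij =>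
    mul_le_mul_of_nonneg_right (pow_le_pow_of_le_one hab0.le hab1.le hij) hB.le
  have hstep : ∀ i < t, matHeight ((b (i + 1)).center - (b i).center) ≤ (b i).radius :=
    fun i hi => by
      have h0 := (b i).radius_nonneg
      refine matHeight_sub_le ((hblack i hi).trans ?_) ((hwhite i hi.le).trans ?_)
      · rw [← hrad i hi.le, ← mul_assoc]
        refine mul_le_of_le_one_left h0 ?_
        nlinarith
      · exact mul_le_of_le_one_left h0 (by linarith)
  -- Here `hαβ` enters, in the form (1-β)α < k⁻¹(1-α); the loss of the factor k comes from rounding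
  -- down to a power of k.
  have hlt : ∀ j, (1 - β) * (α * ((α * β) ^ j * B.radius)) <
      (Fintype.card F : ℝ) ^ moveExp F α ((α * β) ^ j * B.radius) := fun j => by
    have h1 := lt_zpow_moveExp F α ((α * β) ^ j * B.radius)
    have hk := cardF_pos F
    rw [← div_lt_iff₀ hk] at h1
    refine lt_of_le_of_lt ?_ h1
    have h2 : (1 - β) * α ≤ (Fintype.card F : ℝ)⁻¹ * (1 - α) := by linarith
    calc (1 - β) * (α * ((α * β) ^ j * B.radius))
        = (1 - β) * α * ((α * β) ^ j * B.radius) := by ring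
      _ ≤ (Fintype.card F : ℝ)⁻¹ * (1 - α) * ((α * β) ^ j * B.radius) :=
          mul_le_mul_of_nonneg_right h2 (hρ j).le
      _ = (1 - α) * ((α * β) ^ j * B.radius) / Fintype.card F := by ring
  refine ⟨⟨?_, blockStrategy_move_radius hα0.le b t⟩, hrad t le_rfl, ?_, ?_⟩
  · rw [FormalBall.Sub, blockStrategy_move_radius]
    linarith [hwhite t le_rfl]
  · intro i hi
    have : ∀ j, i ≤ j → j ≤ t → matHeight ((b j).center - (b i).center) ≤ (b i).radius := by
      intro j hij
      induction j, hij using Nat.le_induction with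
      | base => intro _; rw [matHeight_sub_self]; exact (b i).radius_nonneg
      | succ j hij ih =>
        intro hj
        refine matHeight_sub_le ((hstep j hj).trans ?_) (ih (by lia))
        rw [hrad j (by lia), hrad i hi]
        exact hanti i j hij
    exact this t hi le_rfl
  · intro i hi
    set τ := n₀ + N * i with hτ
    have hτN : n₀ + N * (i + 1) = τ + N := by rw [hτ]; ring
    rw [hτN] at hi ⊢
    have hdiv : (τ - n₀) / N = i := by
      rw [hτ, Nat.add_sub_cancel_left, Nat.mul_div_cancel_left _ hN]
    have hmove : ((blockStrategy α hα0.le N n₀ st E B).move b τ).center =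
        (b τ).center + E i (b (n₀ + N * st i)).center (b τ).center := by
      rw [blockStrategy_move_center hα0.le hst, blockCenter, if_pos, hdiv]
      exact ⟨by lia, by rw [hτ, Nat.add_sub_cancel_left]; exact dvd_mul_right _ _⟩
    -- Within the block White keeps Black's centre and the radii decrease, so the accumulated drift
    -- obeys the bound for a single displacement.
    have key : ∀ j, 1 ≤ j → j ≤ N → matHeight ((b (τ + j)).center -
        ((blockStrategy α hα0.le N n₀ st E B).move b τ).center) <
          (Fintype.card F : ℝ) ^ moveExp F α ((α * β) ^ τ * B.radius) := by
      intro j hj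
      induction j, hj using Nat.le_induction with
      | base => intro hN1; exact (hblack τ (by lia)).trans_lt (hlt τ)
      | succ j hj ih =>
        intro hjN
        refine matHeight_sub_lt ?_ (ih (by lia))
        have hstill : ((blockStrategy α hα0.le N n₀ st E B).move b (τ + j)).center =
            (b (τ + j)).center := by
          rw [blockStrategy_move_center hα0.le hst, blockCenter, if_neg, add_zero]
          rintro ⟨-, hdvd⟩
          rw [hτ, show n₀ + N * i + j - n₀ = N * i + j by lia, Nat.dvd_add_right
            (dvd_mul_right _ _)] at hdvd
          have := Nat.le_of_dvd (by lia) hdvd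
          lia
        have h1 := hblack (τ + j) (by lia)
        rw [hstill] at h1
        refine (h1.trans ?_).trans_lt (hlt τ)
        refine mul_le_mul_of_nonneg_left (mul_le_mul_of_nonneg_left (hanti _ _ (by lia)) hα0.le) ?_
        linarith
    refine ⟨(b (τ + N)).center - ((blockStrategy α hα0.le N n₀ st E B).move b τ).center,
      key N hN le_rfl, ?_⟩
    rw [hmove]
    abel

end BlockGame

/-! ### A run of moves that secures a whole subspace. -/

section Phase

variable {F : Type*} [Field F] [Fintype F] {ι κ : Type*} [Fintype ι] [Fintype κ]

open Classical in
/-- A move of size at most `k ^ J` that raises the dimension of the secured subspace beyond `v`,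
if there is one. -/
noncomputable def raisingShift (c : ℝ) (V : Submodule (Series F) (ι ⊕ κ → Series F))
    (A : Matrix ι κ (Series F)) (v : ℕ) (J : ℤ) : Matrix ι κ (Series F) :=
  if h : ∃ E : Matrix ι κ (Series F), entryHeight E ≤ (Fintype.card F : ℝ) ^ J ∧
      ∀ G : Matrix ι κ (Series F), entryHeight G < (Fintype.card F : ℝ) ^ J →
        Secured V (A + (E + G)) (v + 1) (c * (Fintype.card F : ℝ) ^ J)
  then h.choose else 0

theorem entryHeight_raisingShift_le (c : ℝ) (V : Submodule (Series F) (ι ⊕ κ → Series F))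
    (A : Matrix ι κ (Series F)) (v : ℕ) (J : ℤ) :
    entryHeight (raisingShift c V A v J) ≤ (Fintype.card F : ℝ) ^ J := by
  rw [raisingShift]
  split_ifs with h
  · exact h.choose_spec.1
  · rw [entryHeight_zero]; exact (zpow_pos (cardF_pos F) J).le

theorem Secured.raisingShift {V : Submodule (Series F) (ι ⊕ κ → Series F)}
    (hV : Module.finrank (Series F) V ≤ Fintype.card κ) {A : Matrix ι κ (Series F)} {v : ℕ}
    {r c : ℝ} {J : ℤ} (hc : 0 < c) (hc1 : c ≤ 1) (hA : c * entryHeight A ≤ 1) (hr : c * r ≤ 1)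
    (hJ : (Fintype.card F : ℝ) ^ J < c * r) (h : Secured V A v r) {G : Matrix ι κ (Series F)}
    (hG : entryHeight G < (Fintype.card F : ℝ) ^ J) :
    Secured V (A + (raisingShift c V A v J + G)) (v + 1) (c * (Fintype.card F : ℝ) ^ J) := by
  rw [BadApprox.raisingShift, dif_pos (h.exists_shift hV hc hc1 hA hr hJ)]
  exact (h.exists_shift hV hc hc1 hA hr hJ).choose_spec.2 G hG

/-- If White raises the dimension of the secured subspace at each of `M ≥ |κ|` consecutive moves,
then in the end all of `V` is secured. -/
theorem exists_secured_of_moves {V : Submodule (Series F) (ι ⊕ κ → Series F)}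
    (hV : Module.finrank (Series F) V ≤ Fintype.card κ) {c α θ ρ : ℝ} (hc : 0 < c) (hc1 : c ≤ 1)
    (hα0 : 0 ≤ α) (hα1 : α < 1) (hθ : 0 < θ) (hθc : θ * Fintype.card F ≤ c ^ 2 * (1 - α))
    (hρ : 0 < ρ) (hρ1 : ρ < 1) {M : ℕ} (hM : Fintype.card κ ≤ M) (C : ℕ → Matrix ι κ (Series F))
    (hC : ∀ i < M, c * entryHeight (C i) ≤ 1)
    (hmove : ∀ i < M, ∃ G : Matrix ι κ (Series F),
      entryHeight G < (Fintype.card F : ℝ) ^ moveExp F α (θ ^ i * ρ) ∧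
      C (i + 1) = C i + (raisingShift c V (C i) i (moveExp F α (θ ^ i * ρ)) + G)) :
    ∃ r, θ ^ M * ρ < r ∧ ∀ A, entryHeight (A - C M) ≤ θ ^ M * ρ → ∀ w ∈ V,
      r * height w ≤ height (affineForms A w) := by
  have hk := cardF_pos F
  have hθ1 : θ ≤ 1 := by
    have h1 : θ ≤ θ * Fintype.card F := le_mul_of_one_le_right hθ.le (one_lt_cardF F).le
    have h2 : c ^ 2 * (1 - α) ≤ 1 :=
      mul_le_one₀ (pow_le_one₀ hc.le hc1) (by linarith) (by linarith)
    linarith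
  have key : ∀ i ≤ M, ∃ r, θ ^ i * ρ < c * r ∧ c * r ≤ 1 ∧ Secured V (C i) i r := by
    intro i
    induction i with
    | zero =>
      intro _
      -- The zero subspace is secured with every factor; `c⁻¹` gives `c * r = 1`, which exceeds `ρ`.
      refine ⟨c⁻¹, ?_, (mul_inv_cancel₀ hc.ne').le, ⊥, bot_le, Or.inl (Nat.zero_le _), ?_⟩
      · rw [mul_inv_cancel₀ hc.ne']; simpa using hρ1
      · intro w hw
        rw [(Submodule.mem_bot _).mp hw]
        simp [height_zero]
    | succ i ih =>
      intro hi
      obtain ⟨r, hr, hr1, hS⟩ := ih (by lia)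
      obtain ⟨G, hG, hCi⟩ := hmove i hi
      have hρi : 0 < θ ^ i * ρ := mul_pos (pow_pos hθ i) hρ
      set q : ℝ := (Fintype.card F : ℝ) ^ moveExp F α (θ ^ i * ρ) with hq
      have hq1 : q ≤ (1 - α) * (θ ^ i * ρ) := zpow_moveExp_le hα1 hρi
      have hq2 : q ≤ θ ^ i * ρ := hq1.trans (mul_le_of_le_one_left hρi.le (by linarith))
      have hq3 : (1 - α) * (θ ^ i * ρ) < q * Fintype.card F := lt_zpow_moveExp F α _
      have hc2 : c ^ 2 ≤ 1 := pow_le_one₀ hc.le hc1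
      -- Securing costs one factor `c` and the next move another, hence the square of `c` in `hθc`;
      -- the factor k there pays for the rounding in `moveExp`.
      refine ⟨c * q, ?_, ?_, ?_⟩
      · refine lt_of_mul_lt_mul_right (a := (Fintype.card F : ℝ)) ?_ hk.le
        calc θ ^ (i + 1) * ρ * Fintype.card F = θ * Fintype.card F * (θ ^ i * ρ) := by ring
          _ ≤ c ^ 2 * (1 - α) * (θ ^ i * ρ) := mul_le_mul_of_nonneg_right hθc hρi.le
          _ = c ^ 2 * ((1 - α) * (θ ^ i * ρ)) := by ring
          _ < c ^ 2 * (q * Fintype.card F) := mul_lt_mul_of_pos_left hq3 (pow_pos hc 2)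
          _ = c * (c * q) * Fintype.card F := by ring
      · calc c * (c * q) = c ^ 2 * q := by ring
          _ ≤ q := mul_le_of_le_one_left (zpow_pos hk _).le hc2
          _ ≤ 1 := (hq2.trans hr.le).trans hr1
      · rw [hCi]
        exact hS.raisingShift hV hc hc1 (hC i hi) hr1 (hq2.trans_lt hr) hG
  obtain ⟨r, hr, hr1, W, hWV, hdim, hW⟩ := key M le_rfl
  have hρM : 0 < θ ^ M * ρ := mul_pos (pow_pos hθ M) hρ
  have hr0 : 0 < r := pos_of_mul_pos_right (hρM.trans hr) hc.le
  have hWeq : W = V := by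
    rcases hdim with h | h
    · exact Submodule.eq_of_le_of_finrank_le hWV ((hV.trans hM).trans h)
    · exact h
  have hrM : θ ^ M * ρ < r := hr.trans_le (mul_le_of_le_one_left hr0.le hc1)
  refine ⟨r, hrM, fun A hA w hw => ?_⟩
  have := le_height_affineForms_add (hW w (hWeq ▸ hw)) (hA.trans_lt hrM)
  rwa [add_sub_cancel] at this

end Phase

/-! ### The game matrix as a restriction of the affine forms. -/

section GameMatrix

variable {F : Type*} [Field F] {m n : ℕ}

/-- Lets a lower bound on the span of the `y i` be read as a lower bound for `gameMat y A`. -/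
theorem affineForms_transpose_sum (y : Fin m → (Fin n ⊕ Fin m → Series F))
    (A : Matrix (Fin m) (Fin n) (Series F)) (u : Fin m → Series F) :
    affineForms Aᵀ (∑ i, u i • y i) = u ᵥ* gameMat y A := by
  rw [map_sum]
  simp_rw [map_smul]
  funext j
  rw [Finset.sum_apply]
  simp only [Matrix.vecMul, dotProduct, Pi.smul_apply, smul_eq_mul, gameMat, Matrix.of_apply]
  refine Finset.sum_congr rfl fun i _ => ?_
  congr 1
  rw [affineForms_apply]
  simp [starMat, dotProduct, Matrix.vecMul, Matrix.col, Matrix.one_apply]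

end GameMatrix

/-! ### The finite game. -/

section FiniteGame

variable {F : Type*} [Field F] [Fintype F] {m n : ℕ}

/-- A left null vector of `G` would contradict `h`. A row of the adjugate times `G` is the
determinant times a unit coordinate vector, so `h` applied to that row bounds its cofactors. -/
theorem le_absL_det {G : Matrix (Fin m) (Fin m) (Series F)} {r : ℝ} (hr : 0 < r)
    (h : ∀ u, r * height u ≤ height (u ᵥ* G)) :
    G.det ≠ 0 ∧ r * height (fun p : Fin m × Fin m => G.adjugate p.1 p.2) ≤ absL G.det := by
  constructor
  · intro hdet
    obtain ⟨u, hu, hu0⟩ := Matrix.exists_vecMul_eq_zero_iff.mpr hdet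
    have := h u
    rw [hu0, height_zero] at this
    exact this.not_gt (mul_pos hr (height_pos hu))
  · rw [mul_comm, ← le_div_iff₀ hr, height_le_iff (div_nonneg (absL_nonneg _) hr.le)]
    rintro ⟨i, j⟩
    rw [le_div_iff₀ hr, mul_comm]
    refine (mul_le_mul_of_nonneg_left (absL_le_height (G.adjugate i) j) hr.le).trans ?_
    refine (h (G.adjugate i)).trans ?_
    have : (G.adjugate i) ᵥ* G = G.det • (1 : Matrix (Fin m) (Fin m) (Series F)) i := by
      rw [← Matrix.mul_apply_eq_vecMul, Matrix.adjugate_mul]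
      rfl
    rw [this, height_smul]
    refine mul_le_of_le_one_right (absL_nonneg _) ((height_le_iff zero_le_one).mpr fun l => ?_)
    rw [Matrix.one_apply]
    split_ifs
    · exact absL_one.le
    · rw [absL_zero]; exact zero_le_one

theorem exists_pow_mul_card_le (F : Type*) [Field F] [Fintype F] {a b : ℝ} (ha0 : 0 < a)
    (ha1 : a < 1) (hb : 0 < b) : ∃ N : ℕ, 0 < N ∧ a ^ N * Fintype.card F ≤ b := by
  obtain ⟨N, hN⟩ := exists_pow_lt_of_lt_one (div_pos hb (cardF_pos F)) ha1
  refine ⟨N + 1, N.succ_pos, ?_⟩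
  rw [← le_div_iff₀ (cardF_pos F)]
  exact (pow_le_pow_of_le_one ha0.le ha1.le N.le_succ).trans hN.le

theorem FormalBall.matHeight_sub_center_le {B B' : FormalBall F m n}
    {A : Matrix (Fin m) (Fin n) (Series F)} (hA : A ∈ B'.toSet)
    (h : matHeight (B'.center - B.center) ≤ B.radius) (hr : B'.radius ≤ B.radius) :
    matHeight (A - B.center) ≤ B.radius :=
  matHeight_sub_le (le_trans hA hr) h

/-- The span of `y` has dimension at most `m`, so `m` moves, `N` rounds apart, suffice. The
threshold `(α * β) ^ (N * m)` keeps the game from stopping before they are made. The bound σ enters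
only through `c`, the inverse of `max σ 1`. -/
theorem exists_winsFiniteGame {α β σ : ℝ} (hα0 : 0 < α) (hα1 : α < 1) (hβ0 : 0 < β) (hβ1 : β < 1)
    (hαβ : 0 < (Fintype.card F : ℝ)⁻¹ + α * β - ((Fintype.card F : ℝ)⁻¹ + 1) * α) :
    ∃ μ₀ : ℝ, 0 < μ₀ ∧
      ∀ (y : Fin m → (Fin n ⊕ Fin m → Series F)) (B : FormalBall F m n) (μ : ℝ),
        IsOrthonormal y → 0 < B.radius → B.radius < 1 →
        (∀ A ∈ B.toSet, matHeight A ≤ σ) → 0 < μ → μ < μ₀ →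
        WinsFiniteGame α β μ y B := by
  have hab0 : 0 < α * β := mul_pos hα0 hβ0
  have hab1 : α * β < 1 := mul_lt_one_of_nonneg_of_lt_one_left hα0.le hα1 hβ1.le
  set c : ℝ := (max σ 1)⁻¹ with hc
  have hσ : 0 < max σ 1 := zero_lt_one.trans_le (le_max_right _ _)
  have hc0 : 0 < c := inv_pos.mpr hσ
  have hc1 : c ≤ 1 := inv_le_one_of_one_le₀ (le_max_right _ _)
  obtain ⟨N, hN, hθ⟩ := exists_pow_mul_card_le F hab0 hab1
    (mul_pos (pow_pos hc0 2) (sub_pos.mpr hα1))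
  refine ⟨(α * β) ^ (N * m), pow_pos hab0 _, fun y B μ hy hB hB1 hBσ hμ hμ0 => ?_⟩
  set V : Submodule (Series F) (Fin n ⊕ Fin m → Series F) :=
    Submodule.span (Series F) (Set.range y) with hV
  have hVdim : Module.finrank (Series F) V ≤ Fintype.card (Fin m) := finrank_range_le_card y
  have hpow : ∀ i, (α * β) ^ (0 + N * i) * B.radius = ((α * β) ^ N) ^ i * B.radius := fun i => by
    rw [zero_add, pow_mul]
  obtain ⟨s, hs⟩ := exists_blockStrategy (n₀ := 0) (st := id)
    (E := fun i _ A => (raisingShift c V Aᵀ i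
      (moveExp F α (((α * β) ^ N) ^ i * B.radius)))ᵀ) hα0 hα1 hβ0 hβ1 hαβ hB hN (fun _ => le_rfl)
    (fun i A A' => by
      rw [hpow, matHeight_eq, entryHeight_transpose]
      exact entryHeight_raisingShift_le _ _ _ _ _)
  refine ⟨s, fun b hb t ht => ?_⟩
  obtain ⟨hmem, hrad, hnest, hmove⟩ := hs b hb t fun i hi => (ht i hi).2
  refine ⟨fun _ => hmem, fun hlt A hA => ?_⟩
  have htN : N * m ≤ t := by
    by_contra! hcon
    have h1 := pow_le_pow_of_le_one hab0.le hab1.le hcon.le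
    rw [hrad] at hlt
    exact absurd (lt_of_mul_lt_mul_right hlt hB.le) (h1.trans' hμ0.le).not_gt
  have hsub : ∀ i ≤ t, (∀ j < i, b (j + 1) ∈ (s.move b j).scaled β) := fun i hi j hj =>
    (ht j (by lia)).2
  have hC : ∀ i < m, c * entryHeight (b (N * i)).centerᵀ ≤ 1 := fun i hi => by
    have hi' : N * i ≤ t := (Nat.mul_le_mul_left N hi.le).trans htN
    rw [entryHeight_transpose]
    have h1 : matHeight (b (N * i)).center ≤ σ := by
      refine hBσ _ ?_
      have := (hs b hb (N * i) (hsub _ hi')).2.2.1 0 (Nat.zero_le _)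
      rwa [hb] at this
    calc c * entryHeight (b (N * i)).center ≤ c * max σ 1 :=
          mul_le_mul_of_nonneg_left (h1.trans (le_max_left _ _)) hc0.le
      _ = 1 := inv_mul_cancel₀ hσ.ne'
  obtain ⟨r, hr, hrA⟩ := exists_secured_of_moves hVdim hc0 hc1 hα0.le hα1 (pow_pos hab0 N) hθ hB hB1
    (M := m) (Fintype.card_fin m).le (fun i => (b (N * i)).centerᵀ) hC (fun i hi => by
      obtain ⟨G, hG, hGi⟩ := hmove i (by
        rw [zero_add]; exact (Nat.mul_le_mul_left N hi).trans htN)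
      rw [hpow] at hG
      refine ⟨Gᵀ, by rwa [entryHeight_transpose], ?_⟩
      simp only [zero_add] at hGi
      rw [hGi, Matrix.transpose_add, Matrix.transpose_add, Matrix.transpose_transpose])
  have hAc : entryHeight (Aᵀ - (b (N * m)).centerᵀ) ≤ ((α * β) ^ N) ^ m * B.radius := by
    rw [← Matrix.transpose_sub, entryHeight_transpose]
    have h1 := (hs b hb (N * m) (hsub _ htN)).2.1
    rw [pow_mul] at h1
    rw [← h1]
    refine FormalBall.matHeight_sub_center_le hA (hnest _ htN) ?_
    rw [hrad, h1, ← pow_mul]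
    exact mul_le_mul_of_nonneg_right (pow_le_pow_of_le_one hab0.le hab1.le htN) hB.le
  have hr0 : 0 < r := (mul_pos (pow_pos (pow_pos hab0 N) m) hB).trans hr
  have hG : ∀ u, r * height u ≤ height (u ᵥ* gameMat y A) := fun u => by
    rw [← hy u, ← affineForms_transpose_sum]
    exact hrA _ hAc _ (Submodule.sum_mem _ fun i _ =>
      Submodule.smul_mem _ _ (Submodule.subset_span ⟨i, rfl⟩))
  obtain ⟨hdet, hadj⟩ := le_absL_det hr0 hG
  have hμr : B.radius * μ < r := by
    refine lt_trans ?_ hr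
    rw [mul_comm, ← pow_mul]
    exact mul_lt_mul_of_pos_right hμ0 hB
  -- If all cofactors vanish, strictness comes from the nonzero determinant rather than from `hμr`.
  rcases (height_nonneg fun p : Fin m × Fin m => (gameMat y A).adjugate p.1 p.2).eq_or_lt
    with h0 | h0
  · rw [← h0, mul_zero]; exact absL_pos hdet
  · exact (mul_lt_mul_of_pos_right hμr h0).trans_le hadj

end FiniteGame

/-! ### Polynomials inside the Laurent series field. -/

section OfPoly

variable {F : Type*} [Field F]

theorem ofPoly_zero : ofPoly (0 : F[X]) = 0 := map_zero _

theorem ofPoly_mul (p q : F[X]) : ofPoly (p * q) = ofPoly p * ofPoly q := map_mul _ p q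

theorem ofPoly_neg (p : F[X]) : ofPoly (-p) = -ofPoly p := map_neg _ p

theorem ofPoly_sum {ι : Type*} (s : Finset ι) (f : ι → F[X]) :
    ofPoly (∑ i ∈ s, f i) = ∑ i ∈ s, ofPoly (f i) := map_sum _ f s

theorem ofPoly_monomial (r : ℕ) (a : F) :
    ofPoly (Polynomial.monomial r a) = HahnSeries.single (-(r : ℤ)) a := by
  have hC : Polynomial.aeval (seriesX F) (Polynomial.C a) = HahnSeries.single (0 : ℤ) a := by
    rw [Polynomial.aeval_C, HahnSeries.algebraMap_apply',
      show (algebraMap F (PowerSeries F)) a = PowerSeries.C a from rfl, HahnSeries.ofPowerSeries_C]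
    rfl
  rw [ofPoly, ← Polynomial.C_mul_X_pow_eq_monomial, map_mul, hC, map_pow, Polynomial.aeval_X,
    seriesX, HahnSeries.single_pow, HahnSeries.single_mul_single]
  simp

theorem coeff_ofPoly_mul {p : F[X]} {a : ℕ} (hp : ∀ r, a ≤ r → p.coeff r = 0) (x : Series F)
    (l : ℤ) : (ofPoly p * x).coeff l = ∑ r : Fin a, p.coeff r * x.coeff (l + r) := by
  have h1 : ofPoly p = ∑ r : Fin a, HahnSeries.single (-(r : ℤ)) (p.coeff r) := by
    have hsum : p = ∑ r : Fin a, Polynomial.monomial (r : ℕ) (p.coeff r) := by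
      ext s
      simp only [Polynomial.finsetSum_coeff, Polynomial.coeff_monomial]
      rcases lt_or_ge s a with hs | hs
      · rw [Finset.sum_eq_single ⟨s, hs⟩ (fun r _ hr => if_neg fun h => hr (Fin.ext h)) (by simp),
          if_pos rfl]
      · rw [hp s hs]
        exact (Finset.sum_eq_zero fun t _ => if_neg (by lia)).symm
    conv_lhs => rw [hsum]
    rw [ofPoly_sum]
    exact Finset.sum_congr rfl fun r _ => ofPoly_monomial _ _
  rw [h1, Finset.sum_mul, HahnSeries.coeff_sum]
  refine Finset.sum_congr rfl fun r _ => ?_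
  rw [HahnSeries.coeff_single_mul, sub_neg_eq_add]

theorem coeff_ofPoly_of_pos (p : F[X]) {l : ℤ} (hl : 0 < l) : (ofPoly p).coeff l = 0 := by
  rw [← mul_one (ofPoly p), coeff_ofPoly_mul (a := p.natDegree + 1)
    fun r hr => Polynomial.coeff_eq_zero_of_natDegree_lt hr]
  refine Finset.sum_eq_zero fun r _ => ?_
  rw [HahnSeries.coeff_one, if_neg (by lia), mul_zero]

theorem coeff_ofPoly_neg (p : F[X]) (r : ℕ) : (ofPoly p).coeff (-(r : ℤ)) = p.coeff r := by
  rw [← mul_one (ofPoly p), coeff_ofPoly_mul (a := max (p.natDegree + 1) (r + 1))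
    fun r hr => Polynomial.coeff_eq_zero_of_natDegree_lt (by lia)]
  rw [Finset.sum_eq_single ⟨r, by lia⟩]
  · simp
  · intro b _ hb
    rw [HahnSeries.coeff_one, if_neg, mul_zero]
    intro h
    exact hb (Fin.ext (by simp only; lia))
  · simp

theorem ofPoly_eq_zero {p : F[X]} : ofPoly p = 0 ↔ p = 0 := by
  refine ⟨fun h => Polynomial.ext fun r => ?_, fun h => by rw [h, ofPoly_zero]⟩
  rw [← coeff_ofPoly_neg, h]; simp

theorem exists_coeff_add_ofPoly_eq_zero (x : Series F) :
    ∃ p : F[X], ∀ l ≤ 0, (x + ofPoly p).coeff l = 0 := by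
  set M : ℕ := (-x.order).toNat + 1 with hM
  refine ⟨-∑ r ∈ Finset.range M, Polynomial.monomial r (x.coeff (-(r : ℤ))), fun l hl => ?_⟩
  obtain ⟨r, rfl⟩ : ∃ r : ℕ, l = -(r : ℤ) := ⟨(-l).toNat, by lia⟩
  rw [HahnSeries.coeff_add, coeff_ofPoly_neg]
  simp only [Polynomial.coeff_neg, Polynomial.finsetSum_coeff, Polynomial.coeff_monomial,
    Finset.sum_ite_eq', Finset.mem_range]
  split_ifs with h
  · ring
  · rw [HahnSeries.coeff_eq_zero_of_lt_order (by lia)]; simp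

variable [Fintype F]

theorem absL_ofPoly_lt_iff {p : F[X]} {a : ℕ} :
    absL (ofPoly p) < (Fintype.card F : ℝ) ^ a ↔ ∀ r, a ≤ r → p.coeff r = 0 := by
  rw [← zpow_natCast, absL_lt_zpow_iff]
  constructor
  · intro h r hr
    rw [← coeff_ofPoly_neg]
    exact h _ (by lia)
  · intro h l hl
    obtain ⟨r, rfl⟩ : ∃ r : ℕ, l = -(r : ℤ) := ⟨(-l).toNat, by lia⟩
    rw [coeff_ofPoly_neg]
    exact h r (by lia)

theorem one_le_absL_ofPoly {p : F[X]} (hp : p ≠ 0) : 1 ≤ absL (ofPoly p) := by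
  by_contra! h
  rw [← pow_zero (Fintype.card F : ℝ), absL_ofPoly_lt_iff] at h
  exact hp (Polynomial.ext fun r => by simpa using h r (Nat.zero_le r))

theorem absL_sum_lt {ι : Type*} (s : Finset ι) (f : ι → Series F) {r : ℝ} (hr : 0 < r)
    (h : ∀ i ∈ s, absL (f i) < r) : absL (∑ i ∈ s, f i) < r :=
  Finset.sum_induction f (fun x => absL x < r) (fun _ _ => absL_add_lt) (by simpa [absL_zero]) h

end OfPoly

/-! ### Integral vectors and block Hankel matrices. -/

section IntegralVectors

variable {F : Type*} [Field F] {ι κ : Type*}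

/-- The vector of Laurent series given by two vectors of polynomials. -/
noncomputable def intVec (q : ι → F[X]) (p : κ → F[X]) : ι ⊕ κ → Series F :=
  Sum.elim (fun i => ofPoly (q i)) fun j => ofPoly (p j)

/-- The matrix of the coefficients `1, …, a` of the products of polynomial vectors of degree less
than `b` with `A`. -/
def hankel (A : Matrix ι κ (Series F)) (b a : ℕ) : Matrix (ι × Fin b) (κ × Fin a) F :=
  Matrix.of fun x y => (A x.1 y.1).coeff ((y.2 : ℤ) + 1 + x.2)

theorem transpose_hankel (A : Matrix ι κ (Series F)) (b a : ℕ) :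
    (hankel A b a)ᵀ = hankel Aᵀ a b := by
  ext x y
  simp only [Matrix.transpose_apply, hankel, Matrix.of_apply]
  congr 1
  ring

variable [Fintype ι]

theorem affineForms_intVec (A : Matrix ι κ (Series F)) (q : ι → F[X]) (p : κ → F[X]) :
    affineForms A (intVec q p) =
      (fun i => ofPoly (q i)) ᵥ* A + fun j => ofPoly (p j) := rfl

/-- Adding polynomials does not change coefficients of positive index. So a zero product means that
`q A` is within less than k^(-a) of a polynomial vector. -/
theorem vecMul_hankel_apply (A : Matrix ι κ (Series F)) {a b : ℕ} {q : ι → F[X]}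
    (hq : ∀ i r, b ≤ r → (q i).coeff r = 0) (j : κ) (t : Fin a) :
    ((fun x : ι × Fin b => (q x.1).coeff x.2) ᵥ* hankel A b a) (j, t) =
      (((fun i => ofPoly (q i)) ᵥ* A) j).coeff ((t : ℤ) + 1) := by
  simp only [Matrix.vecMul, dotProduct, hankel, Matrix.of_apply, HahnSeries.coeff_sum,
    Fintype.sum_prod_type]
  exact Finset.sum_congr rfl fun i _ => (coeff_ofPoly_mul (hq i) (A i j) _).symm

end IntegralVectors

/-! ### Transference between a matrix and its transpose. -/

section Transference

variable {F : Type*} [Field F] [Fintype F] {ι κ : Type*} [Fintype ι] [Fintype κ]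

/-- The integral vectors in the window `‖q‖ < k ^ u`, `‖q A + p‖ < k ^ (-v)`. -/
def windowVectors (A : Matrix ι κ (Series F)) (u v : ℕ) : Set (ι ⊕ κ → Series F) :=
  {z | ∃ (q : ι → F[X]) (p : κ → F[X]), z = intVec q p ∧
    height (fun i => ofPoly (q i)) < (Fintype.card F : ℝ) ^ u ∧
    height (affineForms A (intVec q p)) < (Fintype.card F : ℝ) ^ (-(v : ℤ))}

/-- A nonzero integral vector with `q = 0` has `‖q A + p‖ ≥ 1`. -/
theorem eq_zero_of_affineForms_lt_one {A : Matrix ι κ (Series F)} {q : ι → F[X]} {p : κ → F[X]}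
    (hq : q = 0) (h : height (affineForms A (intVec q p)) < 1) : intVec q p = 0 := by
  have hp : p = 0 := by
    by_contra hp
    obtain ⟨j, hj⟩ := Function.ne_iff.mp hp
    have h1 := (absL_le_height (affineForms A (intVec q p)) j).trans_lt h
    rw [affineForms_intVec, hq] at h1
    have h0 : (fun i : ι => ofPoly ((0 : ι → F[X]) i)) = (0 : ι → Series F) := by
      funext i; exact ofPoly_zero
    rw [h0, Matrix.zero_vecMul, zero_add] at h1
    exact h1.not_ge (one_le_absL_ofPoly hj)
  funext x
  rcases x with i | j
  · simp [intVec, hq, ofPoly_zero]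
  · simp [intVec, hp, ofPoly_zero]

/-- The left kernel of the Hankel matrix is large if there are many independent integral vectors
in the window. -/
theorem le_finrank_ker_hankel {A : Matrix ι κ (Series F)} {u v a b e s : ℕ}
    {z : Fin s → (ι ⊕ κ → Series F)} (hz : LinearIndependent (Series F) z)
    (hzw : ∀ l, z l ∈ windowVectors A u v) (hv : a + e ≤ v) (hu : u + e ≤ b) :
    s * e ≤ Module.finrank F (LinearMap.ker (hankel A b a)ᵀ.mulVecLin) := by
  choose q p hzqp hq hqp using hzw
  have hk := cardF_pos F
  -- Combinations of the `z l` with polynomial coefficients of degree below `e` lose at most a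
  -- factor k^e in each inequality, which `hv` and `hu` leave room for.
  let Ψ : (Fin s → Polynomial.degreeLT F e) →ₗ[F] (ι × Fin b → F) :=
    { toFun := fun g x => (∑ l, (g l : F[X]) * q l x.1).coeff x.2
      map_add' := fun g h => by
        funext x
        simp [add_mul, Finset.sum_add_distrib]
      map_smul' := fun t g => by
        funext x
        simp [Finset.mul_sum] }
  have hdeg : ∀ (g : Fin s → Polynomial.degreeLT F e) l,
      absL (ofPoly (g l : F[X])) < (Fintype.card F : ℝ) ^ e := fun g l => by
    rw [absL_ofPoly_lt_iff]
    exact fun r hr => Polynomial.coeff_eq_zero_of_degree_lt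
      ((Polynomial.mem_degreeLT.mp (g l).2).trans_le (by exact_mod_cast hr))
  have hQ : ∀ (g : Fin s → Polynomial.degreeLT F e) i r, b ≤ r →
      (∑ l, (g l : F[X]) * q l i).coeff r = 0 := fun g i => by
    rw [← absL_ofPoly_lt_iff, ofPoly_sum]
    refine absL_sum_lt _ _ (pow_pos hk b) fun l _ => ?_
    rw [ofPoly_mul, absL_mul]
    calc absL (ofPoly (g l : F[X])) * absL (ofPoly (q l i))
        < (Fintype.card F : ℝ) ^ e * (Fintype.card F : ℝ) ^ u :=
          mul_lt_mul'' (hdeg g l) ((absL_le_height (fun i => ofPoly (q l i)) i).trans_lt (hq l))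
            (absL_nonneg _) (absL_nonneg _)
      _ ≤ (Fintype.card F : ℝ) ^ b := by
          rw [← pow_add]
          exact pow_le_pow_right₀ (one_lt_cardF F).le (by lia)
  have hcomb : ∀ g : Fin s → Polynomial.degreeLT F e,
      intVec (fun i => ∑ l, (g l : F[X]) * q l i) (fun j => ∑ l, (g l : F[X]) * p l j) =
        ∑ l, ofPoly (g l : F[X]) • z l := fun g => by
    funext x
    simp only [hzqp, Finset.sum_apply, Pi.smul_apply, smul_eq_mul]
    rcases x with i | j <;> simp [intVec, ofPoly_sum, ofPoly_mul]
  have hsmall : ∀ (g : Fin s → Polynomial.degreeLT F e) j, absL (affineForms A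
      (intVec (fun i => ∑ l, (g l : F[X]) * q l i) (fun j => ∑ l, (g l : F[X]) * p l j)) j) <
        (Fintype.card F : ℝ) ^ (-(a : ℤ)) := fun g j => by
    rw [hcomb, map_sum, Finset.sum_apply]
    refine absL_sum_lt _ _ (zpow_pos hk _) fun l _ => ?_
    rw [map_smul, Pi.smul_apply, smul_eq_mul, absL_mul, hzqp l]
    calc absL (ofPoly (g l : F[X])) * absL (affineForms A (intVec (q l) (p l)) j)
        < (Fintype.card F : ℝ) ^ e * (Fintype.card F : ℝ) ^ (-(v : ℤ)) :=
          mul_lt_mul'' (hdeg g l) ((absL_le_height _ j).trans_lt (hqp l))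
            (absL_nonneg _) (absL_nonneg _)
      _ ≤ (Fintype.card F : ℝ) ^ (-(a : ℤ)) := by
          rw [← zpow_natCast, ← zpow_add₀ hk.ne']
          exact zpow_le_zpow_right₀ (one_lt_cardF F).le (by lia)
  have hker : LinearMap.range Ψ ≤ LinearMap.ker (hankel A b a)ᵀ.mulVecLin := by
    rintro _ ⟨g, rfl⟩
    rw [LinearMap.mem_ker, Matrix.mulVecLin_apply, Matrix.mulVec_transpose]
    funext ⟨j, t⟩
    have h1 := absL_lt_zpow_iff.mp (hsmall g j) ((t : ℤ) + 1) (by have := t.isLt; lia)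
    rw [affineForms_intVec, Pi.add_apply, HahnSeries.coeff_add,
      coeff_ofPoly_of_pos _ (by lia), add_zero] at h1
    rw [Pi.zero_apply, ← h1]
    exact vecMul_hankel_apply A (hQ g) j t
  -- If the `q` part of a combination vanishes, its forms are polynomials of absolute value below 1,
  -- so the whole combination is zero and independence applies.
  have hinj : Function.Injective Ψ := by
    rw [← LinearMap.ker_eq_bot, LinearMap.ker_eq_bot']
    intro g hg
    have hQ0 : (fun i => ∑ l, (g l : F[X]) * q l i) = 0 := by
      funext i
      refine Polynomial.ext fun r => ?_
      rcases lt_or_ge r b with hr | hr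
      · exact congrFun hg (i, ⟨r, hr⟩)
      · exact hQ g i r hr
    have hz0 := eq_zero_of_affineForms_lt_one (A := A) hQ0
      (p := fun j => ∑ l, (g l : F[X]) * p l j) (by
        refine (height_lt_iff one_pos).mpr fun j => (hsmall g j).trans_le ?_
        exact zpow_le_one_of_nonpos₀ (one_lt_cardF F).le (by lia))
    rw [hcomb] at hz0
    funext l
    exact Subtype.ext (ofPoly_eq_zero.mp (Fintype.linearIndependent_iff.mp hz _ hz0 l))
  calc s * e = Module.finrank F (Fin s → Polynomial.degreeLT F e) := by
        rw [Module.finrank_pi_fintype]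
        simp [(Polynomial.degreeLTEquiv F e).finrank_eq]
    _ = Module.finrank F (LinearMap.range Ψ) := (LinearMap.finrank_range_of_inj hinj).symm
    _ ≤ _ := Submodule.finrank_mono hker

/-- The entries of `x` are the coefficients of `q`. The kernel condition kills the coefficients `1,
…, b` of `q Aᵀ`, and `p` removes those of nonpositive index. -/
theorem exists_int_of_hankel_mulVec {A : Matrix ι κ (Series F)} {a b : ℕ} {x : κ × Fin a → F}
    (hx : x ≠ 0) (hker : hankel A b a *ᵥ x = 0) :
    ∃ (q : κ → F[X]) (p : ι → F[X]), q ≠ 0 ∧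
      height (fun j => ofPoly (q j)) < (Fintype.card F : ℝ) ^ a ∧
      height (affineForms Aᵀ (intVec q p)) < (Fintype.card F : ℝ) ^ (-(b : ℤ)) := by
  have hk := cardF_pos F
  set q : κ → F[X] := fun j => ∑ t : Fin a, Polynomial.monomial (t : ℕ) (x (j, t)) with hqdef
  have hcoeff : ∀ j (t : Fin a), (q j).coeff t = x (j, t) := fun j t => by
    simp only [hqdef, Polynomial.finsetSum_coeff, Polynomial.coeff_monomial]
    rw [Finset.sum_eq_single t (fun r _ hr => if_neg fun h => hr (Fin.ext h)) (by simp), if_pos rfl]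
  have hdeg : ∀ j r, a ≤ r → (q j).coeff r = 0 := fun j r hr => by
    simp only [hqdef, Polynomial.finsetSum_coeff, Polynomial.coeff_monomial]
    exact Finset.sum_eq_zero fun t _ => if_neg (by lia)
  choose p hp using fun i => exists_coeff_add_ofPoly_eq_zero
    (((fun j => ofPoly (q j)) ᵥ* Aᵀ) i)
  refine ⟨q, p, fun h => hx ?_, ?_, ?_⟩
  · funext ⟨j, t⟩
    rw [← hcoeff, h]; simp
  · exact (height_lt_iff (pow_pos hk a)).mpr fun j => absL_ofPoly_lt_iff.mpr (hdeg j)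
  · refine (height_lt_iff (zpow_pos hk _)).mpr fun i => absL_lt_zpow_iff.mpr fun l hl => ?_
    rw [affineForms_intVec, Pi.add_apply]
    rcases le_or_gt l 0 with h0 | h0
    · exact hp i l h0
    · obtain ⟨r, hr⟩ : ∃ r : Fin b, l = (r : ℤ) + 1 := ⟨⟨(l - 1).toNat, by lia⟩, by simp; lia⟩
      rw [HahnSeries.coeff_add, coeff_ofPoly_of_pos _ h0, add_zero, hr,
        ← vecMul_hankel_apply Aᵀ hdeg i r, ← transpose_hankel, Matrix.vecMul_transpose]
      have : (fun y : κ × Fin a => (q y.1).coeff y.2) = x := funext fun y => hcoeff y.1 y.2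
      rw [this, hker]
      rfl

/-- Many independent integral vectors in a window of `A` give an integral vector in a window of
the transpose. -/
theorem exists_int_transpose {A : Matrix ι κ (Series F)} {u v a b e s : ℕ}
    {z : Fin s → (ι ⊕ κ → Series F)} (hz : LinearIndependent (Series F) z)
    (hzw : ∀ l, z l ∈ windowVectors A u v) (hv : a + e ≤ v) (hu : u + e ≤ b)
    (hcard : Fintype.card ι * b < s * e + Fintype.card κ * a) :
    ∃ (q : κ → F[X]) (p : ι → F[X]), q ≠ 0 ∧
      height (fun j => ofPoly (q j)) < (Fintype.card F : ℝ) ^ a ∧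
      height (affineForms Aᵀ (intVec q p)) < (Fintype.card F : ℝ) ^ (-(b : ℤ)) := by
  classical
  have h1 := le_finrank_ker_hankel hz hzw hv hu
  have h2 := LinearMap.finrank_range_add_finrank_ker (hankel A b a).mulVecLin
  have h3 := LinearMap.finrank_range_add_finrank_ker (hankel A b a)ᵀ.mulVecLin
  have h4 := Matrix.rank_transpose (hankel A b a)
  rw [Matrix.rank, Matrix.rank] at h4
  rw [Module.finrank_fintype_fun_eq_card, Fintype.card_prod, Fintype.card_fin] at h2 h3
  -- Row rank equals column rank, so the left kernel exceeds the right one by `|ι| b - |κ| a` in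
  -- dimension; the left one has dimension at least `s * e`, which is larger.
  have h5 : 0 < Module.finrank F (LinearMap.ker (hankel A b a).mulVecLin) := by lia
  have := Module.finrank_pos_iff.mp h5
  obtain ⟨⟨x, hx⟩, hx0⟩ := exists_ne (0 : LinearMap.ker (hankel A b a).mulVecLin)
  exact exists_int_of_hankel_mulVec (x := x) (fun h => hx0 (Subtype.ext h))
    (LinearMap.mem_ker.mp hx)

end Transference

/-! ### Guarded ranges and their advance during one phase. -/

section Guarded

variable {F : Type*} [Field F] [Fintype F] {ι κ : Type*} [Fintype ι] [Fintype κ]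

theorem one_le_height_ofPoly {q : ι → F[X]} (hq : q ≠ 0) : 1 ≤ height fun i => ofPoly (q i) := by
  obtain ⟨i, hi⟩ := Function.ne_iff.mp hq
  exact (one_le_absL_ofPoly hi).trans (absL_le_height (fun i => ofPoly (q i)) i)

/-- The integral vectors with `0 < ‖q‖ < k ^ u` satisfy `‖q A + p‖ ≥ k ^ (-w)`. -/
def Guarded (A : Matrix ι κ (Series F)) (u w : ℕ) : Prop :=
  ∀ (q : ι → F[X]) (p : κ → F[X]), q ≠ 0 →
    height (fun i => ofPoly (q i)) < (Fintype.card F : ℝ) ^ u →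
    (Fintype.card F : ℝ) ^ (-(w : ℤ)) ≤ height (affineForms A (intVec q p))

theorem guarded_zero (A : Matrix ι κ (Series F)) (w : ℕ) : Guarded A 0 w := fun q p hq h => by
  rw [pow_zero] at h
  exact absurd h (one_le_height_ofPoly hq).not_gt

/-- With `|κ| + 1` independent vectors in the window, transference would produce an integral vector
for `Aᵀ` that the guard `h` forbids. -/
theorem Guarded.finrank_span_windowVectors_le {A : Matrix ι κ (Series F)} {d X Y Δ L C' : ℕ}
    (hd : Fintype.card ι + Fintype.card κ = d) (hι : 0 < Fintype.card ι) (hYX : Y ≤ X)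
    (hXY : X ≤ Y + Δ) (hL : d * Δ + C' < L)
    (h : Guarded Aᵀ (Fintype.card ι * Y - Fintype.card κ * L)
      (Fintype.card κ * Y + Fintype.card κ * L + C')) :
    Module.finrank (Series F) (Submodule.span (Series F) (windowVectors A
      (Fintype.card κ * X - Fintype.card ι * L) (Fintype.card ι * X + Fintype.card ι * L))) ≤
        Fintype.card κ := by
  set i := Fintype.card ι
  set k := Fintype.card κ
  set u := k * X - i * L with hu
  set v := i * X + i * L with hv
  -- The exponent is a truncated difference; when it is 0, only `q = 0` is admitted and the window
  -- contains just the zero vector.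
  rcases Nat.eq_zero_or_pos u with hu0 | hu0
  · have : Submodule.span (Series F) (windowVectors A u v) = ⊥ := by
      rw [Submodule.span_eq_bot]
      rintro z ⟨q, p, rfl, hq, hqp⟩
      have hq0 : q = 0 := by
        by_contra hne
        rw [hu0, pow_zero] at hq
        exact hq.not_ge (one_le_height_ofPoly hne)
      refine eq_zero_of_affineForms_lt_one hq0 (hqp.trans_le ?_)
      exact zpow_le_one_of_nonpos₀ (one_lt_cardF F).le (by lia)
    rw [this, finrank_bot]
    exact Nat.zero_le _
  by_contra! hcon
  obtain ⟨f, hf, -, hli⟩ :=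
    Submodule.exists_fun_fin_finrank_span_eq (Series F) (windowVectors A u v)
  have hz : LinearIndependent (Series F) fun l : Fin (k + 1) => f (Fin.castLE hcon l) :=
    hli.comp _ (Fin.castLE_injective hcon)
  -- Small enough that `a ≤ i * Y - k * L`, so that `h` applies, yet large enough that `i * X - a <
  -- (k + 1) * L`, which the count in `exists_int_transpose` needs.
  set a := i * X - k * L - (d * Δ + C') with ha
  have hav : a ≤ v := by lia
  have hiX : i * X ≤ a + k * L + (d * Δ + C') := by lia
  obtain ⟨q, p, hq, hqa, hqp⟩ := exists_int_transpose (a := a) (e := v - a) (b := u + (v - a)) hz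
    (fun l => hf _) (by lia) le_rfl (by
      change i * (u + (v - a)) < (k + 1) * (v - a) + k * a
      have hu' : (u : ℤ) = k * X - i * L := by rw [hu, Nat.cast_sub (by lia)]; push_cast; ring
      zify [hav] at *
      have h1 : ((i : ℤ) - 1) * (i * X - a) ≤ (i - 1) * ((k + 1) * L) :=
        mul_le_mul_of_nonneg_left (by linarith) (by linarith)
      have h2 : (0 : ℤ) < (k + 1) * L := by
        have : (0 : ℤ) < L := by
          have : (0 : ℤ) ≤ d * Δ + C' := by positivity
          linarith
        positivity
      rw [hu', hv]
      linarith)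
  have ha0 : 0 < a := by
    rw [Nat.pos_iff_ne_zero]
    intro h0
    rw [h0, pow_zero] at hqa
    exact hqa.not_ge (one_le_height_ofPoly hq)
  have hiXY : i * X ≤ i * Y + d * Δ := by
    calc i * X ≤ i * (Y + Δ) := Nat.mul_le_mul_left i hXY
      _ = i * Y + i * Δ := by ring
      _ ≤ i * Y + d * Δ := by gcongr; lia
  have hkYX : k * Y ≤ k * X := Nat.mul_le_mul_left k hYX
  have h1 := h q p hq (hqa.trans_le (pow_le_pow_right₀ (one_lt_cardF F).le (by lia)))
  have h2 := (zpow_lt_zpow_iff_right₀ (one_lt_cardF F)).mp (h1.trans_lt hqp)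
  lia

/-- In one phase of the game the guarded window moves on. -/
theorem guarded_advance {d X Y Y' Δ L C' : ℕ} (hd : Fintype.card ι + Fintype.card κ = d)
    (hι : 0 < Fintype.card ι) {c α θ ρ : ℝ} (hc : 0 < c) (hc1 : c ≤ 1)
    (hα0 : 0 ≤ α) (hα1 : α < 1) (hθ : 0 < θ) (hθc : θ * Fintype.card F ≤ c ^ 2 * (1 - α))
    (hρ : 0 < ρ) (hρ1 : ρ < 1) (hρX : (Fintype.card F : ℝ) ^ (d * X) * ρ ≤ 1)
    (hρX' : 1 < (Fintype.card F : ℝ) ^ (d * (X + 1)) * ρ) (hYX : Y ≤ X) (hXY : X ≤ Y + Δ)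
    (hYX' : Y' ≤ X) (hXY' : X ≤ Y' + Δ)
    (hC' : (Fintype.card F : ℝ) ^ (d + d * Δ) ≤ θ ^ d * (Fintype.card F : ℝ) ^ C')
    (hL : d * Δ + C' < L) (C : ℕ → Matrix ι κ (Series F))
    (hC : ∀ i < d, c * entryHeight (C i) ≤ 1)
    (hmove : ∀ i < d, ∃ G : Matrix ι κ (Series F),
      entryHeight G < (Fintype.card F : ℝ) ^ moveExp F α (θ ^ i * ρ) ∧
      C (i + 1) = C i + (raisingShift c (Submodule.span (Series F) (windowVectors (C 0)
        (Fintype.card κ * X - Fintype.card ι * L) (Fintype.card ι * X + Fintype.card ι * L)))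
        (C i) i (moveExp F α (θ ^ i * ρ)) + G))
    (hguard : Guarded (C 0)ᵀ (Fintype.card ι * Y' - Fintype.card κ * L)
      (Fintype.card κ * Y' + Fintype.card κ * L + C')) {A : Matrix ι κ (Series F)}
    (hAd : entryHeight (A - C d) ≤ θ ^ d * ρ) (hA0 : entryHeight (A - C 0) ≤ ρ)
    (hA : Guarded A (Fintype.card κ * Y - Fintype.card ι * L)
      (Fintype.card ι * Y + Fintype.card ι * L + C')) :
    Guarded A (Fintype.card κ * X - Fintype.card ι * L)
      (Fintype.card ι * X + Fintype.card ι * L + C') := by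
  have hk := cardF_pos F
  have hk1 := (one_lt_cardF F).le
  obtain ⟨r, hr, hrA⟩ := exists_secured_of_moves
    (hguard.finrank_span_windowVectors_le hd hι hYX' hXY' hL) hc hc1 hα0 hα1 hθ hθc hρ hρ1
    (M := d) (by lia) C hC hmove
  intro q p hq hqu
  set i := Fintype.card ι
  set k := Fintype.card κ
  set u := k * X - i * L with hu
  set v := i * X + i * L with hv
  set u' := k * Y - i * L with hu'
  -- Short `q` are covered by the earlier guard. For longer `q` there are two cases: if the forms
  -- are small at `C 0`, the vector lies in the window and hence in the secured span; if they are
  -- large there, they stay large on the whole ball, because k^(u + v) ρ ≤ 1.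
  rcases lt_or_ge (height fun i => ofPoly (q i)) ((Fintype.card F : ℝ) ^ u') with hlt | hge
  · refine le_trans (zpow_le_zpow_right₀ hk1 ?_) (hA q p hq hlt)
    have : i * Y ≤ i * X := Nat.mul_le_mul_left i hYX
    lia
  have hq1 := one_le_height_ofPoly hq
  have hudX : u + v = d * X := by
    have : 0 < u := by
      by_contra! h0
      rw [Nat.le_zero.mp h0, pow_zero] at hqu
      exact hqu.not_ge hq1
    rw [← hd, add_mul]
    lia
  rcases lt_or_ge (height (affineForms (C 0) (intVec q p)))
    ((Fintype.card F : ℝ) ^ (-(v : ℤ))) with hsmall | hlarge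
  · have h1 := hrA A hAd _ (Submodule.subset_span ⟨q, p, rfl, hqu, hsmall⟩)
    refine le_trans ?_ h1
    have h2 : (Fintype.card F : ℝ) ^ u' ≤ height (intVec q p) :=
      hge.trans (height_comp_le (intVec q p) Sum.inl)
    refine le_trans ?_ (mul_le_mul hr.le h2 (by positivity) (hr.trans' (by positivity)).le)
    rw [zpow_neg, zpow_natCast, inv_le_iff_one_le_mul₀ (by positivity)]
    have hkX : d * (X + 1) ≤ (u' + v) + (d + d * Δ) := by
      have h3 : k * X ≤ k * Y + k * Δ := by
        rw [← mul_add]; exact Nat.mul_le_mul_left k hXY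
      have h4 : k * Δ ≤ d * Δ := Nat.mul_le_mul_right Δ (by lia)
      have h5 : d * X = i * X + k * X := by rw [← hd, add_mul]
      have h6 : d * (X + 1) = d * X + d := by ring
      lia
    calc (1 : ℝ) ≤ (Fintype.card F : ℝ) ^ (d * (X + 1)) * ρ := hρX'.le
      _ ≤ (Fintype.card F : ℝ) ^ ((u' + v) + (d + d * Δ)) * ρ := by gcongr
      _ = (Fintype.card F : ℝ) ^ (u' + v) * (Fintype.card F : ℝ) ^ (d + d * Δ) * ρ := by
          rw [pow_add _ (u' + v)]
      _ ≤ (Fintype.card F : ℝ) ^ (u' + v) * (θ ^ d * (Fintype.card F : ℝ) ^ C') * ρ := by gcongr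
      _ = θ ^ d * ρ * (Fintype.card F : ℝ) ^ u' * (Fintype.card F : ℝ) ^ (v + C') := by
          rw [pow_add, pow_add]; ring
  · refine le_trans (zpow_le_zpow_right₀ hk1 (by lia)) (b := (Fintype.card F : ℝ) ^ (-(v : ℤ))) ?_
    have h1 : A = C 0 + (A - C 0) := by abel
    rw [h1, affineForms_add]
    refine le_height_add hlarge ((height_vecMul_le _ _).trans_lt ?_)
    have h2 : (height fun i => ofPoly (q i)) * entryHeight (A - C 0) <
        (Fintype.card F : ℝ) ^ u * ρ :=
      (mul_le_mul_of_nonneg_left hA0 (height_nonneg _)).trans_lt (mul_lt_mul_of_pos_right hqu hρ)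
    refine h2.trans_le ?_
    rw [zpow_neg, zpow_natCast, le_inv_comm₀ (by positivity) (by positivity), ← one_div,
      le_div_iff₀ (by positivity)]
    calc (Fintype.card F : ℝ) ^ v * ((Fintype.card F : ℝ) ^ u * ρ)
        = (Fintype.card F : ℝ) ^ (u + v) * ρ := by rw [pow_add]; ring
      _ ≤ 1 := by rw [hudX]; exact hρX

end Guarded

/-! ### The game for badly approximable matrices. -/

section Play

variable {F : Type*} [Field F] [Fintype F] {m n : ℕ}

/-- White's move number `i` in the game for `𝔅(m,n)`: in the phases of `m + n` moves, White works
alternately against the integral vectors in windows of the transposed matrix and of the matrix. -/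
noncomputable def alternatingShift (c α θ ρ : ℝ) (X : ℕ → ℕ) (L i : ℕ)
    (A₀ A : Matrix (Fin m) (Fin n) (Series F)) : Matrix (Fin m) (Fin n) (Series F) :=
  if Even (i / (m + n)) then
    (raisingShift c (Submodule.span (Series F) (windowVectors A₀ᵀ
      (m * X (i / (m + n)) - n * L) (n * X (i / (m + n)) + n * L))) Aᵀ (i % (m + n))
      (moveExp F α (θ ^ i * ρ)))ᵀ
  else
    raisingShift c (Submodule.span (Series F) (windowVectors A₀
      (n * X (i / (m + n)) - m * L) (m * X (i / (m + n)) + m * L))) A (i % (m + n))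
      (moveExp F α (θ ^ i * ρ))

theorem entryHeight_alternatingShift_le (c α θ ρ : ℝ) (X : ℕ → ℕ) (L i : ℕ)
    (A₀ A : Matrix (Fin m) (Fin n) (Series F)) :
    entryHeight (alternatingShift c α θ ρ X L i A₀ A) ≤
      (Fintype.card F : ℝ) ^ moveExp F α (θ ^ i * ρ) := by
  rw [alternatingShift]
  split_ifs
  · rw [entryHeight_transpose]; exact entryHeight_raisingShift_le _ _ _ _ _
  · exact entryHeight_raisingShift_le _ _ _ _ _

/-- Phases for the same matrix are two apart, so `guarded_advance` is applied with `2 * Δ`; its dual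
guard comes from the phase just before, which treated the other matrix. -/
theorem guarded_of_alternatingShift (hm : 0 < m) (hn : 0 < n) {c α θ ρ : ℝ} (hc : 0 < c)
    (hc1 : c ≤ 1) (hα0 : 0 ≤ α) (hα1 : α < 1) (hθ : 0 < θ) (hθ1 : θ ≤ 1)
    (hθc : θ * Fintype.card F ≤ c ^ 2 * (1 - α))
    (hρ : 0 < ρ) (hρ1 : ρ < 1) {X : ℕ → ℕ} {Δ L C' : ℕ}
    (hX : ∀ j, (Fintype.card F : ℝ) ^ ((m + n) * X j) * (θ ^ ((m + n) * j) * ρ) ≤ 1)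
    (hX' : ∀ j, 1 < (Fintype.card F : ℝ) ^ ((m + n) * (X j + 1)) * (θ ^ ((m + n) * j) * ρ))
    (hmono : ∀ j, X j ≤ X (j + 1)) (hstep : ∀ j, X (j + 1) ≤ X j + Δ)
    (hC' : (Fintype.card F : ℝ) ^ ((m + n) + (m + n) * (2 * Δ)) ≤
      θ ^ (m + n) * (Fintype.card F : ℝ) ^ C')
    (hL : (m + n) * (2 * Δ) + C' < L) (hL0 : (m + n) * X 0 ≤ L)
    (C : ℕ → Matrix (Fin m) (Fin n) (Series F))
    (hC : ∀ i, c * entryHeight (C i) ≤ 1)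
    (hmove : ∀ i, ∃ G : Matrix (Fin m) (Fin n) (Series F),
      entryHeight G < (Fintype.card F : ℝ) ^ moveExp F α (θ ^ i * ρ) ∧
      C (i + 1) = C i +
        (alternatingShift c α θ ρ X L i (C ((m + n) * (i / (m + n)))) (C i) + G))
    (hnest : ∀ i j, i ≤ j → ∀ A, entryHeight (A - C j) ≤ θ ^ j * ρ →
      entryHeight (A - C i) ≤ θ ^ i * ρ) (i : ℕ) :
    ∀ A, entryHeight (A - C ((m + n) * (2 * i + 2))) ≤ θ ^ ((m + n) * (2 * i + 2)) * ρ →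
      Guarded A (n * X (2 * i + 1) - m * L) (m * X (2 * i + 1) + m * L + C') := by
  set d := m + n with hd
  have hd0 : 0 < d := by lia
  have hself : ∀ j, entryHeight (C j - C j) ≤ θ ^ j * ρ := fun j => by
    rw [sub_self, entryHeight_zero]; positivity
  have hρj : ∀ j, 0 < θ ^ (d * j) * ρ := fun j => by positivity
  have hρj1 : ∀ j, θ ^ (d * j) * ρ < 1 := fun j =>
    (mul_le_of_le_one_left hρ.le (pow_le_one₀ hθ.le hθ1)).trans_lt hρ1
  have hradius : ∀ j v, θ ^ v * (θ ^ (d * j) * ρ) = θ ^ (d * j + v) * ρ := fun j v => by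
    rw [pow_add]; ring
  have hmove' : ∀ j, ∀ v < d, ∃ G : Matrix (Fin m) (Fin n) (Series F),
      entryHeight G < (Fintype.card F : ℝ) ^ moveExp F α (θ ^ v * (θ ^ (d * j) * ρ)) ∧
      C (d * j + (v + 1)) = C (d * j + v) +
        (alternatingShift c α θ ρ X L (d * j + v) (C (d * j)) (C (d * j + v)) + G) := by
    intro j v hv
    obtain ⟨G, hG, hG'⟩ := hmove (d * j + v)
    refine ⟨G, by rwa [hradius], ?_⟩
    rwa [Nat.mul_add_div hd0, Nat.div_eq_of_lt hv, add_zero] at hG'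
  have hphase : ∀ j v, v < d → (d * j + v) / d = j ∧ (d * j + v) % d = v := fun j v hv =>
    ⟨by rw [Nat.mul_add_div hd0, Nat.div_eq_of_lt hv, add_zero],
      by rw [Nat.mul_add_mod, Nat.mod_eq_of_lt hv]⟩
  have hdual : ∀ j, Even j → ∀ Y Y', Y ≤ X j → X j ≤ Y + 2 * Δ → Y' ≤ X j → X j ≤ Y' + 2 * Δ →
      Guarded (C (d * j)) (n * Y' - m * L) (m * Y' + m * L + C') →
      ∀ A, entryHeight (A - C (d * (j + 1))) ≤ θ ^ (d * (j + 1)) * ρ →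
        Guarded Aᵀ (m * Y - n * L) (n * Y + n * L + C') →
        Guarded Aᵀ (m * X j - n * L) (n * X j + n * L + C') := by
    intro j hj Y Y' h1 h2 h3 h4 hg A hA hgA
    have hA' := hnest (d * j) (d * (j + 1)) (Nat.mul_le_mul_left d j.le_succ) A hA
    have := guarded_advance (F := F) (ι := Fin n) (κ := Fin m) (d := d) (X := X j) (Y := Y)
      (Y' := Y') (Δ := 2 * Δ) (L := L) (C' := C') (by simp [hd, add_comm]) (by simpa using hn)
      hc hc1 hα0 hα1 hθ hθc (hρj j) (hρj1 j) (hX j) (hX' j) h1 h2 h3 h4 hC' hL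
      (fun v => (C (d * j + v))ᵀ) (fun v _ => by rw [entryHeight_transpose]; exact hC _)
      (fun v hv => by
        obtain ⟨G, hG, hG'⟩ := hmove' j v hv
        refine ⟨Gᵀ, by rwa [entryHeight_transpose], ?_⟩
        rw [hG', alternatingShift, (hphase j v hv).1, (hphase j v hv).2, if_pos hj, hradius]
        simp only [Fintype.card_fin, add_zero, Matrix.transpose_add, Matrix.transpose_transpose])
      (A := Aᵀ) (by simpa using hg) (by
        rw [← Matrix.transpose_sub, entryHeight_transpose, hradius]; exact hA) (by
        rw [← Matrix.transpose_sub, entryHeight_transpose]; exact hA') (by simpa using hgA)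
    simpa using this
  have hprim : ∀ j, ¬ Even j → ∀ Y Y', Y ≤ X j → X j ≤ Y + 2 * Δ → Y' ≤ X j →
      X j ≤ Y' + 2 * Δ →
      Guarded (C (d * j))ᵀ (m * Y' - n * L) (n * Y' + n * L + C') →
      ∀ A, entryHeight (A - C (d * (j + 1))) ≤ θ ^ (d * (j + 1)) * ρ →
        Guarded A (n * Y - m * L) (m * Y + m * L + C') →
        Guarded A (n * X j - m * L) (m * X j + m * L + C') := by
    intro j hj Y Y' h1 h2 h3 h4 hg A hA hgA
    have hA' := hnest (d * j) (d * (j + 1)) (Nat.mul_le_mul_left d j.le_succ) A hA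
    have := guarded_advance (F := F) (ι := Fin m) (κ := Fin n) (d := d) (X := X j) (Y := Y)
      (Y' := Y') (Δ := 2 * Δ) (L := L) (C' := C') (by simp [hd]) (by simpa using hm)
      hc hc1 hα0 hα1 hθ hθc (hρj j) (hρj1 j) (hX j) (hX' j) h1 h2 h3 h4 hC' hL
      (fun v => C (d * j + v)) (fun v _ => hC _)
      (fun v hv => by
        obtain ⟨G, hG, hG'⟩ := hmove' j v hv
        refine ⟨G, hG, ?_⟩
        rw [hG', alternatingShift, (hphase j v hv).1, (hphase j v hv).2, if_neg hj, hradius]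
        simp only [Fintype.card_fin, add_zero])
      (A := A) (by simpa using hg) (by rw [hradius]; exact hA) hA' (by simpa using hgA)
    simpa using this
  -- For `i = 0` both truncated indices are 0, and `hL0` makes both guarded ranges empty.
  have hinv : ∀ i A, entryHeight (A - C (d * (2 * i))) ≤ θ ^ (d * (2 * i)) * ρ →
      Guarded Aᵀ (m * X (2 * i - 2) - n * L) (n * X (2 * i - 2) + n * L + C') ∧
      Guarded A (n * X (2 * i - 1) - m * L) (m * X (2 * i - 1) + m * L + C') := by
    intro i
    induction i with
    | zero =>
      intro A _
      have h1 : m * X 0 ≤ d * X 0 := Nat.mul_le_mul_right _ (by lia)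
      have h2 : n * X 0 ≤ d * X 0 := Nat.mul_le_mul_right _ (by lia)
      have h3 : L ≤ n * L := Nat.le_mul_of_pos_left L hn
      have h4 : L ≤ m * L := Nat.le_mul_of_pos_left L hm
      rw [Nat.sub_eq_zero_of_le (n := m * X (2 * 0 - 2)) ((h1.trans hL0).trans h3),
        Nat.sub_eq_zero_of_le (n := n * X (2 * 0 - 1)) ((h2.trans hL0).trans h4)]
      exact ⟨guarded_zero _ _, guarded_zero _ _⟩
    | succ i hg =>
      have hs0 := hstep (2 * i)
      have hm0 := hmono (2 * i)
      have hY : X (2 * i - 2) ≤ X (2 * i) ∧ X (2 * i) ≤ X (2 * i - 2) + 2 * Δ := by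
        cases i with
        | zero => simp
        | succ i =>
          have := hstep (2 * i)
          have := hstep (2 * i + 1)
          have := hmono (2 * i)
          have := hmono (2 * i + 1)
          rw [show 2 * (i + 1) - 2 = 2 * i by lia, show 2 * (i + 1) = 2 * i + 1 + 1 by ring]
          lia
      have hY' : X (2 * i - 1) ≤ X (2 * i) ∧ X (2 * i) ≤ X (2 * i - 1) + Δ := by
        cases i with
        | zero => simp
        | succ i => exact ⟨hmono (2 * i + 1), hstep (2 * i + 1)⟩
      have hD : ∀ A, entryHeight (A - C (d * (2 * i + 1))) ≤ θ ^ (d * (2 * i + 1)) * ρ →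
          Guarded Aᵀ (m * X (2 * i) - n * L) (n * X (2 * i) + n * L + C') := fun A hA =>
        hdual (2 * i) (even_two_mul i) _ _ hY.1 hY.2 hY'.1 (by lia) (hg _ (hself _)).2 A hA
          (hg A (hnest _ _ (Nat.mul_le_mul_left d (by lia)) A hA)).1
      refine fun A hA => ⟨hD A (hnest _ _ (Nat.mul_le_mul_left d (by lia)) A hA), ?_⟩
      exact hprim (2 * i + 1) (by simp) _ (X (2 * i)) (hY'.1.trans hm0) (by lia) hm0 (by lia)
        (hD _ (hself _)) A hA (hg A (hnest _ _ (Nat.mul_le_mul_left d (by lia)) A hA)).2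
  exact fun A hA => (hinv (i + 1) A hA).2

/-- A matrix all of whose windows are guarded is badly approximable. -/
theorem mem_badlyApproximable_of_guarded {A : Matrix (Fin m) (Fin n) (Series F)} {X : ℕ → ℕ}
    {Δ L C' : ℕ} (hm : 0 < m) (hn : 0 < n) (hX0 : n * X 0 ≤ L + n * Δ) (hstep : ∀ i, X (i + 1) ≤ X i + Δ)
    (hX : ∀ T, ∃ i, T ≤ X i)
    (hA : ∀ i, Guarded A (n * X i - m * L) (m * X i + m * L + C')) :
    A ∈ badlyApproximable F m n := by
  classical
  have hk := cardF_pos F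
  have hk1 := (one_lt_cardF F).le
  set T : ℕ := m * (m * L + n * Δ) + n * (m * L + C') with hT
  -- The factor 1/2 serves only to make the inequality strict.
  refine ⟨((Fintype.card F : ℝ) ^ T)⁻¹ / 2, by positivity, fun q hq => ?_⟩
  have hq1 := one_le_height_ofPoly hq
  set H := height fun i => ofPoly (q i) with hH
  have hH0 : 0 < H := zero_lt_one.trans_le hq1
  -- The first range containing `q`: by minimality its length exceeds ‖q‖ by a bounded factor only.
  obtain ⟨i, hi, hiH⟩ : ∃ i, H < (Fintype.card F : ℝ) ^ (n * X i - m * L) ∧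
      (Fintype.card F : ℝ) ^ (n * X i) ≤ H * (Fintype.card F : ℝ) ^ (m * L + n * Δ) := by
    have hex : ∃ i, H < (Fintype.card F : ℝ) ^ (n * X i - m * L) := by
      obtain ⟨T, hT⟩ := pow_unbounded_of_one_lt H (one_lt_cardF F)
      obtain ⟨i, hi⟩ := hX (T + m * L)
      refine ⟨i, hT.trans_le (pow_le_pow_right₀ hk1 ?_)⟩
      have := Nat.le_mul_of_pos_left (X i) hn
      lia
    refine ⟨Nat.find hex, Nat.find_spec hex, ?_⟩
    rcases h : Nat.find hex with _ | i
    · refine le_trans (pow_le_pow_right₀ hk1 ?_) (le_mul_of_one_le_left (by positivity) hq1)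
      have := Nat.le_mul_of_pos_left L hm
      lia
    · have hmin := not_lt.mp (Nat.find_min hex (m := i) (by lia))
      refine le_trans ?_ (mul_le_mul_of_nonneg_right hmin (by positivity))
      rw [← pow_add]
      refine pow_le_pow_right₀ hk1 ?_
      have := Nat.mul_le_mul_left n (hstep i)
      rw [mul_add] at this
      lia
  set w := m * X i + m * L + C' with hw
  have hdist : (Fintype.card F : ℝ) ^ (-(w : ℤ)) ≤
      latticeDist ((fun i => ofPoly (q i)) ᵥ* A) := by
    refine le_ciInf fun p => (hA i q (-p) hq hi).trans_eq ?_
    rw [affineForms_intVec]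
    congr 1
    funext j
    simp [ofPoly_neg, sub_eq_add_neg]
  refine lt_of_lt_of_le ?_ (pow_le_pow_left₀ (by positivity) hdist n)
  rw [zpow_neg, zpow_natCast, inv_pow, div_div, div_lt_iff₀ (by positivity), inv_mul_eq_div,
    lt_div_iff₀ (by positivity), inv_mul_lt_iff₀ (by positivity)]
  have h1 : (Fintype.card F : ℝ) ^ (m * (n * X i)) ≤
      H ^ m * (Fintype.card F : ℝ) ^ (m * (m * L + n * Δ)) := by
    have := pow_le_pow_left₀ (by positivity) hiH m
    rwa [mul_pow, ← pow_mul, ← pow_mul, mul_comm (n * X i), mul_comm (m * L + n * Δ)] at this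
  calc ((Fintype.card F : ℝ) ^ w) ^ n
      = (Fintype.card F : ℝ) ^ (m * (n * X i)) * (Fintype.card F : ℝ) ^ (n * (m * L + C')) := by
        rw [← pow_mul, ← pow_add]; congr 1; rw [hw]; ring
    _ ≤ H ^ m * (Fintype.card F : ℝ) ^ (m * (m * L + n * Δ)) *
          (Fintype.card F : ℝ) ^ (n * (m * L + C')) := by gcongr
    _ = (Fintype.card F : ℝ) ^ T * H ^ m := by rw [hT, pow_add]; ring
    _ < (Fintype.card F : ℝ) ^ T * (2 * H ^ m) := by
        have : 0 < H ^ m := by positivity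
        gcongr
        linarith

/-- `X j` is the largest integer with k^(d X j) at most the inverse radius at phase `j`. Since a
phase multiplies the radius by θ^d, any Δ with k^Δ > θ⁻¹ bounds the increments. -/
theorem exists_window_exponents {d : ℕ} (hd : 0 < d) {θ ρ : ℝ} (hθ : 0 < θ) (hθ1 : θ < 1)
    (hρ : 0 < ρ) (hρ1 : ρ < 1) :
    ∃ (X : ℕ → ℕ) (Δ C' : ℕ),
      (∀ j, (Fintype.card F : ℝ) ^ (d * X j) * (θ ^ (d * j) * ρ) ≤ 1) ∧
      (∀ j, 1 < (Fintype.card F : ℝ) ^ (d * (X j + 1)) * (θ ^ (d * j) * ρ)) ∧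
      (∀ j, X j ≤ X (j + 1)) ∧ (∀ j, X (j + 1) ≤ X j + Δ) ∧ (∀ T, ∃ j, T ≤ X j) ∧
      (Fintype.card F : ℝ) ^ (d + d * (2 * Δ)) ≤ θ ^ d * (Fintype.card F : ℝ) ^ C' := by
  have hk := cardF_pos F
  have hk1 := (one_lt_cardF F).le
  have hρj : ∀ j, 0 < θ ^ (d * j) * ρ := fun j => by positivity
  have hanti : ∀ j, θ ^ (d * (j + 1)) * ρ ≤ θ ^ (d * j) * ρ := fun j =>
    mul_le_mul_of_nonneg_right
      (pow_le_pow_of_le_one hθ.le hθ1.le (Nat.mul_le_mul_left d j.le_succ)) hρ.le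
  have hex : ∀ j, ∃ X : ℕ, (Fintype.card F : ℝ) ^ (d * X) * (θ ^ (d * j) * ρ) ≤ 1 ∧
      1 < (Fintype.card F : ℝ) ^ (d * (X + 1)) * (θ ^ (d * j) * ρ) := fun j => by
    have h1 : 1 ≤ 1 / (θ ^ (d * j) * ρ) := by
      rw [le_div_iff₀ (hρj j), one_mul]
      exact mul_le_one₀ (pow_le_one₀ hθ.le hθ1.le) hρ.le hρ1.le
    obtain ⟨X, hX, hX'⟩ := exists_nat_pow_near h1
      (one_lt_pow₀ (one_lt_cardF F) hd.ne')
    rw [← pow_mul, le_div_iff₀ (hρj j)] at hX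
    rw [← pow_mul, div_lt_iff₀ (hρj j)] at hX'
    exact ⟨X, hX, hX'⟩
  choose X hX hX' using hex
  obtain ⟨Δ, hΔ⟩ := pow_unbounded_of_one_lt θ⁻¹ (one_lt_cardF F)
  have hΔ' : 1 ≤ θ * (Fintype.card F : ℝ) ^ Δ := by
    rw [← div_le_iff₀' hθ, one_div]; exact hΔ.le
  obtain ⟨C', hC'⟩ := pow_unbounded_of_one_lt
    ((Fintype.card F : ℝ) ^ (d + d * (2 * Δ)) / θ ^ d) (one_lt_cardF F)
  have hmono : ∀ j, X j ≤ X (j + 1) := fun j => by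
    by_contra! h
    refine (hX' (j + 1)).not_ge (le_trans ?_ (hX j))
    exact mul_le_mul (pow_le_pow_right₀ hk1 (Nat.mul_le_mul_left d h)) (hanti j) (hρj _).le
      (by positivity)
  refine ⟨X, Δ, C', hX, hX', hmono, fun j => ?_, fun T => ?_, ?_⟩
  · by_contra! h
    refine (hX (j + 1)).not_gt ((hX' j).trans_le ?_)
    calc (Fintype.card F : ℝ) ^ (d * (X j + 1)) * (θ ^ (d * j) * ρ)
        ≤ (Fintype.card F : ℝ) ^ (d * (X j + 1)) * (θ ^ (d * j) * ρ) *
            (θ * (Fintype.card F : ℝ) ^ Δ) ^ d :=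
          le_mul_of_one_le_right (by positivity) (one_le_pow₀ hΔ')
      _ = (Fintype.card F : ℝ) ^ (d * (X j + 1 + Δ)) * (θ ^ (d * (j + 1)) * ρ) := by ring
      _ ≤ (Fintype.card F : ℝ) ^ (d * X (j + 1)) * (θ ^ (d * (j + 1)) * ρ) := by
          refine mul_le_mul_of_nonneg_right (pow_le_pow_right₀ hk1 ?_) (hρj _).le
          exact Nat.mul_le_mul_left d (by lia)
  · obtain ⟨j, hj⟩ := exists_pow_lt_of_lt_one
      (show (0 : ℝ) < 1 / (Fintype.card F : ℝ) ^ (d * T) by positivity) hθ1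
    refine ⟨j, ?_⟩
    by_contra! h
    refine (hX' j).not_ge ?_
    rw [lt_div_iff₀ (by positivity)] at hj
    have h1 : θ ^ (d * j) * ρ ≤ θ ^ j :=
      (mul_le_of_le_one_right (by positivity) hρ1.le).trans
        (pow_le_pow_of_le_one hθ.le hθ1.le (Nat.le_mul_of_pos_left j hd))
    calc (Fintype.card F : ℝ) ^ (d * (X j + 1)) * (θ ^ (d * j) * ρ)
        ≤ (Fintype.card F : ℝ) ^ (d * T) * θ ^ j :=
          mul_le_mul (pow_le_pow_right₀ hk1 (Nat.mul_le_mul_left d h)) h1 (hρj j).le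
            (by positivity)
      _ ≤ 1 := by rw [mul_comm]; exact hj.le
  · rw [div_lt_iff₀' (by positivity)] at hC'
    exact hC'.le

theorem isWinning_badlyApproximable (hm : 0 < m) (hn : 0 < n) {α β : ℝ} (hα0 : 0 < α)
    (hα1 : α < 1) (hβ0 : 0 < β) (hβ1 : β < 1)
    (hαβ : 0 < (Fintype.card F : ℝ)⁻¹ + α * β - ((Fintype.card F : ℝ)⁻¹ + 1) * α) :
    IsWinning α β (badlyApproximable F m n) := by
  have hab0 : 0 < α * β := mul_pos hα0 hβ0
  have hab1 : α * β < 1 := mul_lt_one_of_nonneg_of_lt_one_left hα0.le hα1 hβ1.le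
  suffices ∀ B : FormalBall F m n, 0 < B.radius → ∃ s : Strategy F m n,
      ∀ b : ℕ → FormalBall F m n, b 0 = B →
        (∀ t, (∀ i < t, b (i + 1) ∈ (s.move b i).scaled β) → s.move b t ∈ (b t).scaled α) ∧
        ((∀ i, b (i + 1) ∈ (s.move b i).scaled β) →
          (⋂ i, (b i).toSet) ⊆ badlyApproximable F m n) by
    classical
    choose s hs using this
    -- The constants depend on Black's first ball, so the strategy reads them off the head of the
    -- list; the default balls never occur in a play.
    let S : Strategy F m n := fun l =>
      if h : 0 < (l.headD ⟨0, 0, le_rfl⟩).radius then s _ h l else ⟨0, 0, le_rfl⟩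
    refine ⟨S, fun b hb => ?_⟩
    have hmove : ∀ t, S.move b t = (s (b 0) hb).move b t := fun t => by
      have hhead : ((List.range (t + 1)).map b).headD ⟨0, 0, le_rfl⟩ = b 0 := by
        rw [List.range_succ_eq_map]; rfl
      simp only [Strategy.move, S]
      simp only [hhead, dif_pos hb]
    simp only [hmove]
    exact hs (b 0) hb b rfl
  intro B hB
  set σ : ℝ := max (max (matHeight B.center) B.radius) 1 with hσ
  have hσ1 : 1 ≤ σ := le_max_right _ _
  have hσ0 : 0 < σ := zero_lt_one.trans_le hσ1
  set c : ℝ := σ⁻¹ with hc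
  have hc0 : 0 < c := inv_pos.mpr hσ0
  have hc1 : c ≤ 1 := inv_le_one_of_one_le₀ hσ1
  obtain ⟨N, hN, hθc⟩ := exists_pow_mul_card_le F hab0 hab1
    (mul_pos (pow_pos hc0 2) (sub_pos.mpr hα1))
  -- White idles for `n₀` rounds to bring the radius below 1.
  obtain ⟨n₀, hn₀⟩ := exists_pow_lt_of_lt_one (div_pos one_pos hB) hab1
  set θ : ℝ := (α * β) ^ N with hθ
  have hθ0 : 0 < θ := pow_pos hab0 N
  have hθ1 : θ < 1 := pow_lt_one₀ hab0.le hab1 hN.ne'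
  set ρ : ℝ := (α * β) ^ n₀ * B.radius with hρ
  have hρ0 : 0 < ρ := by positivity
  have hρ1 : ρ < 1 := by rwa [lt_div_iff₀ hB] at hn₀
  have hpow : ∀ i, (α * β) ^ (n₀ + N * i) * B.radius = θ ^ i * ρ := fun i => by
    rw [pow_add, pow_mul, hρ]; ring
  obtain ⟨X, Δ, C', hX, hX', hmono, hstep, hlarge, hC'⟩ :=
    exists_window_exponents (F := F) (d := m + n) (by lia) hθ0 hθ1 hρ0 hρ1
  set L : ℕ := (m + n) * (2 * Δ) + C' + 1 + (m + n) * X 0 with hL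
  obtain ⟨s, hs⟩ := exists_blockStrategy (n₀ := n₀) (st := fun i => (m + n) * (i / (m + n)))
    (E := alternatingShift c α θ ρ X L) hα0 hα1 hβ0 hβ1 hαβ hB hN
    (fun i => Nat.mul_div_le i (m + n)) (fun i A A' => by
      rw [hpow]; exact entryHeight_alternatingShift_le _ _ _ _ _ _ _ _ _)
  refine ⟨s, fun b hb => ⟨fun t ht => (hs b hb t ht).1, fun hlegal A hA => ?_⟩⟩
  rw [Set.mem_iInter] at hA
  have hs' := fun t => hs b hb t fun i _ => hlegal i
  have hrad : ∀ i, (b (n₀ + N * i)).radius = θ ^ i * ρ := fun i => by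
    rw [(hs' _).2.1, hpow]
  have hguard := guarded_of_alternatingShift hm hn hc0 hc1 hα0.le hα1 hθ0 hθ1.le hθc hρ0 hρ1
    hX hX' hmono hstep hC' (L := L) (by lia) (by lia) (fun i => (b (n₀ + N * i)).center)
    (fun i => by
      have h1 : matHeight ((b (n₀ + N * i)).center - B.center) ≤ B.radius := by
        have := (hs' (n₀ + N * i)).2.2.1 0 (Nat.zero_le _)
        rwa [hb] at this
      have h2 : entryHeight (b (n₀ + N * i)).center ≤ σ := by
        rw [← sub_add_cancel (b (n₀ + N * i)).center B.center]
        exact entryHeight_add_le (h1.trans ((le_max_right _ _).trans (le_max_left _ _)))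
          ((le_max_left _ _).trans (le_max_left _ _))
      calc c * entryHeight (b (n₀ + N * i)).center ≤ c * σ :=
            mul_le_mul_of_nonneg_left h2 hc0.le
        _ = 1 := inv_mul_cancel₀ hσ0.ne')
    (fun i => by
      obtain ⟨G, hG, hG'⟩ := (hs' (n₀ + N * (i + 1))).2.2.2 i le_rfl
      rw [hpow] at hG
      exact ⟨G, hG, hG'⟩)
    (fun i j hij A hA => by
      have hle : n₀ + N * i ≤ n₀ + N * j := by gcongr
      have h1 := (hs' (n₀ + N * j)).2.2.1 _ hle
      rw [hrad] at h1
      refine matHeight_sub_le (hA.trans ?_) h1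
      exact mul_le_mul_of_nonneg_right (pow_le_pow_of_le_one hθ0.le hθ1.le hij) hρ0.le)
  -- The matrix itself, as opposed to its transpose, is treated in the odd phases only.
  refine mem_badlyApproximable_of_guarded hm hn (X := fun i => X (2 * i + 1)) (Δ := 2 * Δ)
    (L := L) (C' := C') ?_ (fun i => ?_) (fun T => ?_) fun i => hguard i A ?_
  · have h1 := Nat.mul_le_mul_left n (hstep 0)
    have h2 : n * X 0 ≤ (m + n) * X 0 := Nat.mul_le_mul_right _ (by lia)
    have h3 : n * Δ ≤ n * (2 * Δ) := Nat.mul_le_mul_left n (by lia)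
    rw [mul_add] at h1
    simp only [mul_zero, zero_add] at h1 ⊢
    lia
  · have h1 := hstep (2 * i + 1)
    have h2 := hstep (2 * i + 1 + 1)
    change X (2 * i + 1 + 1 + 1) ≤ _
    lia
  · obtain ⟨j, hj⟩ := hlarge T
    exact ⟨j, hj.trans (monotone_nat_of_le_succ hmono (by lia))⟩
  · rw [← hrad]
    exact hA _

end Play

/-! ### The winning dimension. -/

section WinningDimension

variable {F : Type*} [Field F] [Fintype F] {m n : ℕ}

/-- The condition on α and β equals k⁻¹(1 - (k+1)α) + αβ > 0, which holds for every β > 0 once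
(k+1)α < 1. -/
theorem isAlphaWinning_badlyApproximable (hm : 0 < m) (hn : 0 < n) {α : ℝ} (hα0 : 0 < α)
    (hα : α < 1 / ((Fintype.card F : ℝ) + 1)) : IsAlphaWinning α (badlyApproximable F m n) := by
  intro β hβ0 hβ1
  have hk := cardF_pos F
  rw [lt_div_iff₀ (by positivity)] at hα
  refine isWinning_badlyApproximable hm hn hα0 (by nlinarith) hβ0 hβ1 ?_
  have h1 : ((Fintype.card F : ℝ)⁻¹ + 1) * α =
      (Fintype.card F : ℝ)⁻¹ * (α * ((Fintype.card F : ℝ) + 1)) := by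
    field_simp
    ring
  have h2 : (Fintype.card F : ℝ)⁻¹ * (α * ((Fintype.card F : ℝ) + 1)) < (Fintype.card F : ℝ)⁻¹ :=
    mul_lt_of_lt_one_right (inv_pos.mpr hk) hα
  have h3 : 0 < α * β := mul_pos hα0 hβ0
  linarith

theorem le_windim {S : Set (Matrix (Fin m) (Fin n) (Series F))} {a : ℝ} (ha0 : 0 < a)
    (ha1 : a < 1) (h : ∀ α, 0 < α → α < a → IsAlphaWinning α S) : a ≤ windim S := by
  have hmem : ∀ α, 0 < α → α < a → α ∈ {α : ℝ | 0 < α ∧ α < 1 ∧ IsAlphaWinning α S} :=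
    fun α h0 h1 => ⟨h0, h1.trans ha1, h α h0 h1⟩
  have hbdd : BddAbove {α : ℝ | 0 < α ∧ α < 1 ∧ IsAlphaWinning α S} :=
    ⟨1, fun α hα => hα.2.1.le⟩
  rw [windim, if_neg (Set.Nonempty.ne_empty ⟨a / 2, hmem _ (by linarith) (by linarith)⟩)]
  refine le_of_forall_lt fun b hb => ?_
  obtain ⟨x, hx1, hx2⟩ := exists_between (max_lt hb ha0)
  exact ((le_max_left _ _).trans_lt hx1).trans_le
    (le_csSup hbdd (hmem x ((le_max_right _ _).trans_lt hx1) hx2))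

end WinningDimension

end BadApprox

open BadApprox in
theorem theorem2 {F : Type*} [Field F] [Fintype F] (m n : ℕ) (hm : 0 < m) (hn : 0 < n) :
    (∀ α β : ℝ, 0 < α → α < 1 → 0 < β → β < 1 →
      0 < (Fintype.card F : ℝ)⁻¹ + α * β - ((Fintype.card F : ℝ)⁻¹ + 1) * α →
      (∀ σ : ℝ, 0 < σ → ∃ μ₀ : ℝ, 0 < μ₀ ∧
        ∀ (y : Fin m → (Fin n ⊕ Fin m → Series F)) (B : FormalBall F m n) (μ : ℝ),
          IsOrthonormal y → 0 < B.radius → B.radius < 1 →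
          (∀ A ∈ B.toSet, matHeight A ≤ σ) → 0 < μ → μ < μ₀ →
          WinsFiniteGame α β μ y B) ∧
      IsWinning α β (badlyApproximable F m n)) ∧
    (∀ α : ℝ, 0 < α → α < 1 / ((Fintype.card F : ℝ) + 1) →
      IsAlphaWinning α (badlyApproximable F m n)) ∧
    1 / ((Fintype.card F : ℝ) + 1) ≤ windim (badlyApproximable F m n) := by
  have hk := cardF_pos F
  refine ⟨fun α β hα0 hα1 hβ0 hβ1 hαβ => ⟨fun σ _ =>
    exists_winsFiniteGame hα0 hα1 hβ0 hβ1 hαβ,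
    isWinning_badlyApproximable hm hn hα0 hα1 hβ0 hβ1 hαβ⟩,
    fun α hα0 hα => isAlphaWinning_badlyApproximable hm hn hα0 hα,
    le_windim (by positivity) ?_ fun α hα0 hα => isAlphaWinning_badlyApproximable hm hn hα0 hα⟩
  rw [div_lt_one (by positivity)]
  linarith
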